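/- Let $\mathbb{D}$ be the open unit disc, $\mathbb{T}$ the unit circle and $m$ the normalized Lebesgue measure on $\mathbb{T}$. A closed set $E\subseteq\mathbb{T}$ is a Beurling–Carleson set if $\sum_k |A_k|\log(1/|A_k|)<\infty$, where $\mathbb{T}\setminus E=\bigcup_k A_k$ is the decomposition into disjoint open arcs and $|A_k|$ is the length of $A_k$. For such a set $E$ with $m(E)>0$, let $a_k,b_k$ be the endpoints of $A_k$, and put $\phi_E(\zeta)=|(\zeta-a_k)(\zeta-b_k)|$ for $\zeta\in A_k$ and $\phi_E(\zeta)=1$ for $\zeta\in E$. (i) For every Beurling–Carleson set $E$ with $m(E)>0$ we have $\log\phi_E\in L^1(\mathbb{T},m)$. (ii) For every integer $n\ge 0$ there is $N_0=N_0(n)$ such that the following holds for every integer $N\ge N_0$, every Beurling–Carleson set $E$ with $m(E)>0$ and all finite positive Borel measures $\nu_1,\nu_2$ concentrated on $E$. Let $$s(z)=\exp\Big(\int_{\mathbb{T}}\frac{\zeta+z}{\zeta-z}\log\big(\phi_E(\zeta)^N\big)\,dm(\zeta)\Big),\qquad g_l(z)=\exp\Big(-\int_E\frac{\zeta+z}{\zeta-z}\,d\nu_l(\zeta)\Big),\qquad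 z\in\mathbb{D},\ l=1,2,$$ so that $s$ is the outer function with boundary modulus $\phi_E^N$. Then $g_1$, $g_2$ and $s$ have limits from within $\mathbb{D}$ at every point of $\mathbb{T}\setminus E$, and, with these boundary values, the $2\pi$-periodic function $$F(t)=\overline{g_1(e^{it})}\,g_2(e^{it})\,s(e^{it})\,1_{\mathbb{T}\setminus E}(e^{it})$$ (equal to $0$ when $e^{it}\in E$) belongs to $C^n(\mathbb{R})$. -/

import Mathlib

open Complex MeasureTheory Set Filter Topology

namespace BeurlingCarleson

/-- Normalized Lebesgue measure `m` on the unit circle `𝕋 = {z : ℂ | ‖z‖ = 1}`, as a (probability)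
measure on `ℂ`: the image of `dt / 2π` on `(-π, π]` under `t ↦ e^{it}`. -/
noncomputable def circleMeasure : Measure ℂ :=
  (ENNReal.ofReal (2 * Real.pi))⁻¹ •
    Measure.map (fun t : ℝ => exp (t * I)) (volume.restrict (Ioc (-Real.pi) Real.pi))

/-- The open circular arc `{e^{it} : p.1 < t < p.2}`. -/
def openArc (p : ℝ × ℝ) : Set ℂ := (fun t : ℝ => exp (t * I)) '' Ioo p.1 p.2

/-- The arcs complementary to a closed nonempty set `E ⊆ 𝕋`, i.e. the connected components of
`𝕋 \ E`, as pairs of angles `(α, β)`: the open arc from `e^{iα}` to `e^{iβ}` misses `E` and both its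
endpoints are in `E`.  The normalization `0 ≤ α < 2π` makes every arc occur exactly once; the
length of the arc is `β - α`. -/
def complementaryArcs (E : Set ℂ) : Set (ℝ × ℝ) :=
  {p | 0 ≤ p.1 ∧ p.1 < 2 * Real.pi ∧ p.1 < p.2 ∧ p.2 ≤ p.1 + 2 * Real.pi ∧
    Disjoint (openArc p) E ∧ exp (p.1 * I) ∈ E ∧ exp (p.2 * I) ∈ E}

/-- `E` is a Beurling–Carleson set: a closed subset of the unit circle whose complementary arcs
`A_k` satisfy `∑ₖ |A_k| log (1 / |A_k|) < ∞`.  (At most six terms are negative, so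
convergence of the series is the same as summability.) -/
def IsBeurlingCarleson (E : Set ℂ) : Prop :=
  IsClosed E ∧ E ⊆ Metric.sphere 0 1 ∧
    Summable fun p : complementaryArcs E =>
      (p.1.2 - p.1.1) * Real.log (1 / (p.1.2 - p.1.1))

open scoped Classical in
/-- `φ(ζ) = |(ζ - a)(ζ - b)|` if `ζ` lies in the complementary arc of `E` with endpoints `a`, `b`
(the arc containing `ζ` is unique), and `φ(ζ) = 1` otherwise, in particular on `E`. -/
noncomputable def phi (E : Set ℂ) (ζ : ℂ) : ℝ :=
  if h : ∃ p ∈ complementaryArcs E, ζ ∈ openArc p then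
    ‖(ζ - exp (h.choose.1 * I)) * (ζ - exp (h.choose.2 * I))‖
  else 1

/-- The outer function on the unit disc with boundary modulus `k` (for `log k ∈ L¹(m)`). -/
noncomputable def outerFunction (k : ℂ → ℝ) (z : ℂ) : ℂ :=
  exp (∫ ζ, (ζ + z) / (ζ - z) * (Real.log (k ζ) : ℂ) ∂circleMeasure)

/-- `z ↦ exp (-∫_E (ζ + z) / (ζ - z) dν(ζ))` on the unit disc. -/
noncomputable def singularExp (E : Set ℂ) (ν : Measure ℂ) (z : ℂ) : ℂ :=
  exp (-∫ ζ in E, (ζ + z) / (ζ - z) ∂ν)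

/-- The boundary value at `ζ ∈ 𝕋` of a function on the unit disc: its limit at `ζ` from within the
disc.  It is meaningful only where this limit exists. -/
noncomputable def boundaryValue (f : ℂ → ℂ) (ζ : ℂ) : ℂ :=
  limUnder (𝓝[Metric.ball 0 1] ζ) f

/-- The limit of `f` at `ζ` from within the unit disc exists. -/
def HasBoundaryValue (f : ℂ → ℂ) (ζ : ℂ) : Prop :=
  ∃ w, Tendsto f (𝓝[Metric.ball 0 1] ζ) (𝓝 w)

/-- The function `conj(g₁) g₂ s 1_{𝕋 \ E}` on the circle, formed with boundary values. -/
noncomputable def cutoff (E : Set ℂ) (g₁ g₂ s : ℂ → ℂ) : ℂ → ℂ :=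
  (Metric.sphere 0 1 \ E).indicator fun ζ =>
    (starRingEnd ℂ) (boundaryValue g₁ ζ) * boundaryValue g₂ ζ * boundaryValue s ζ

end BeurlingCarleson

/-! ### Integration on the circle, the Schwarz formula and explicit outer functions. -/

namespace BeurlingCarleson

/-! Lift `E` to its closed periodic set of angles. Let `t` lie in a gap `(α, β)` at distance `d`
from the endpoints, and let `a`, `b` be the corresponding points of `E`.

For (i), on a gap of length `L` both factors of `φ` are comparable from below to `d` and at most
`2`, so the integral of `|log φ|` is at most `C L + 4 L log (1/L)`. The lengths are summable, and
the Carleson condition handles the other term.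

For (ii), the outer function with boundary modulus `|ζ - a|` is `1 - conj a * z`
(`exp_integral_log_norm_sub`). Hence `s` is the `N`-th power of two such linear factors times the
exponential of the Herglotz integral of `logRatio`, which vanishes on the arc. That integral, and
those of `ν₁`, `ν₂`, therefore continue holomorphically across the arc. On the arc `g₁` is
unimodular, so `conj g₁ = 1 / g₁` also continues.

Near a circle point at distance `δ` from its mass, a Herglotz integral varies by at most the total
mass on a disc of radius `δ² / 4`, and its real part vanishes at the centre (`norm_herglotz_sub_le`,
`re_herglotz_eq_zero`). So on a disc of radius comparable to `d²` about `t` the continuation of `F`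
is bounded by a constant times `d ^ N`: the exponentials are bounded uniformly in the gap, and the
linear factors together give `O(d)`. Cauchy's estimate yields `|F⁽ᵏ⁾(t)| ≤ C d ^ (N - 2k)`. For `N ≥
2n + 2` and `k ≤ n` this is quadratically small at `E`, so the extension by zero is `C^n`
(`contDiff_of_norm_iteratedDeriv_le`). -/

theorem ae_circleMeasure_norm_eq_one : ∀ᵐ ζ ∂circleMeasure, ‖ζ‖ = 1 := by
  refine Measure.ae_smul_measure ?_ _
  rw [ae_map_iff (by fun_prop) (measurableSet_eq_fun (by fun_prop) (by fun_prop))]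
  exact Eventually.of_forall fun t => norm_exp_ofReal_mul_I t

theorem ae_circleMeasure_ne (a : ℂ) : ∀ᵐ ζ ∂circleMeasure, ζ ≠ a := by
  refine Measure.ae_smul_measure ?_ _
  rw [ae_map_iff (p := fun ζ => ζ ≠ a) (by fun_prop) (measurableSet_singleton a).compl]
  refine ae_restrict_of_ae ?_
  rw [ae_iff]
  refine ((countable_singleton a).preimage_circleMap 0 one_ne_zero).mono ?_ |>.measure_zero _
  intro t ht
  simpa [circleMap] using ht

instance isFiniteMeasure_circleMeasure : IsFiniteMeasure circleMeasure := by
  unfold circleMeasure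
  refine Measure.smul_finite _ ?_
  simp [Real.pi_pos]

theorem periodic_comp_exp {α : Type*} (f : ℂ → α) :
    Function.Periodic (fun t : ℝ => f (exp (t * I))) (2 * Real.pi) := by
  intro t
  have h : exp (((t + 2 * Real.pi : ℝ) : ℂ) * I) = exp (t * I) := by
    push_cast
    rw [add_mul, exp_add, exp_two_pi_mul_I, mul_one]
  simp only [h]

theorem circleAverage_eq_integral_exp {E : Type*} [NormedAddCommGroup E] [NormedSpace ℝ E]
    (f : ℂ → E) :
    Real.circleAverage f 0 1 =
      (2 * Real.pi)⁻¹ • ∫ t in Ioc (-Real.pi) Real.pi, f (exp (t * I)) := by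
  have h := (periodic_comp_exp f).intervalIntegral_add_eq 0 (-Real.pi)
  rw [Real.circleAverage_def, ← intervalIntegral.integral_of_le (by linarith [Real.pi_pos])]
  rw [show -Real.pi + 2 * Real.pi = Real.pi by ring, zero_add] at h
  rw [← h]
  simp [circleMap]

theorem integral_circleMeasure {E : Type*} [NormedAddCommGroup E] [NormedSpace ℝ E]
    {f : ℂ → E} (hf : AEStronglyMeasurable f circleMeasure) :
    ∫ ζ, f ζ ∂circleMeasure = Real.circleAverage f 0 1 := by
  have hc : (ENNReal.ofReal (2 * Real.pi))⁻¹ ≠ 0 := by simp [ENNReal.mul_eq_top]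
  have hf' : AEStronglyMeasurable f (Measure.map (fun t : ℝ => exp (t * I))
      (volume.restrict (Ioc (-Real.pi) Real.pi))) := by
    refine hf.mono_ac ?_
    exact (Measure.AbsolutelyContinuous.rfl.smul_right hc)
  rw [circleMeasure, integral_smul_measure, integral_map (by fun_prop) hf',
    circleAverage_eq_integral_exp, ENNReal.toReal_inv, ENNReal.toReal_ofReal (by positivity)]

theorem integrable_circleMeasure_iff {E : Type*} [NormedAddCommGroup E]
    {f : ℂ → E} (hf : AEStronglyMeasurable f circleMeasure) :
    Integrable f circleMeasure ↔
      IntegrableOn (fun t : ℝ => f (exp (t * I))) (Ioc (-Real.pi) Real.pi) := by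
  have hc : (ENNReal.ofReal (2 * Real.pi))⁻¹ ≠ 0 := by simp [ENNReal.mul_eq_top]
  have hf' : AEStronglyMeasurable f (Measure.map (fun t : ℝ => exp (t * I))
      (volume.restrict (Ioc (-Real.pi) Real.pi))) := by
    refine hf.mono_ac ?_
    exact (Measure.AbsolutelyContinuous.rfl.smul_right hc)
  rw [circleMeasure, integrable_smul_measure hc (by simp [Real.pi_pos]),
    integrable_map_measure hf' (by fun_prop)]
  rfl

theorem circleIntegrable_iff_integrableOn {E : Type*} [NormedAddCommGroup E] (f : ℂ → E) :
    CircleIntegrable f 0 1 ↔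
      IntegrableOn (fun t : ℝ => f (exp (t * I))) (Ioc (-Real.pi) Real.pi) := by
  have h := (periodic_comp_exp f).intervalIntegrable_iff (t₁ := 0) (t₂ := -Real.pi)
  rw [show -Real.pi + 2 * Real.pi = Real.pi by ring, zero_add] at h
  rw [← intervalIntegrable_iff_integrableOn_Ioc_of_le (by linarith [Real.pi_pos]), ← h]
  simp [CircleIntegrable, circleMap]

theorem integrable_log_norm_sub (a : ℂ) :
    Integrable (fun ζ : ℂ => Real.log ‖ζ - a‖) circleMeasure := by
  rw [integrable_circleMeasure_iff (Measurable.aestronglyMeasurable (by fun_prop)),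
    ← circleIntegrable_iff_integrableOn (fun ζ : ℂ => Real.log ‖ζ - a‖)]
  exact circleIntegrable_log_norm_sub_const 1

/-- The logarithm has mean zero (Jensen) and is at most `log 2`, so its negative part is controlled
by its positive part. The bound does not depend on `a`, which later makes the estimates uniform over
gaps. -/
theorem integral_norm_log_norm_sub_le {a : ℂ} (ha : ‖a‖ = 1) :
    ∫ ζ, ‖Real.log ‖ζ - a‖‖ ∂circleMeasure ≤ 2 * Real.log 2 := by
  have h0 : ∫ ζ, Real.log ‖ζ - a‖ ∂circleMeasure = 0 := by
    rw [integral_circleMeasure (Measurable.aestronglyMeasurable (by fun_prop))]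
    exact circleAverage_log_norm_sub_const₁ ha
  have h1 : ∀ᵐ ζ ∂circleMeasure, ‖Real.log ‖ζ - a‖‖ ≤ 2 * Real.log 2 - Real.log ‖ζ - a‖ := by
    filter_upwards [ae_circleMeasure_norm_eq_one] with ζ hζ
    have h2 : ‖ζ - a‖ ≤ 2 := (norm_sub_le _ _).trans (by rw [hζ, ha]; norm_num)
    have h3 : Real.log ‖ζ - a‖ ≤ Real.log 2 := by
      rcases eq_or_ne ‖ζ - a‖ 0 with h | h
      · rw [h, Real.log_zero]; exact Real.log_nonneg (by norm_num)
      · exact Real.log_le_log (by positivity) h2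
    have h4 : 0 ≤ Real.log 2 := Real.log_nonneg (by norm_num)
    rw [Real.norm_eq_abs, abs_le]
    exact ⟨by linarith, by linarith⟩
  have hm : circleMeasure.real univ = 1 := by
    have := integral_circleMeasure (f := fun _ : ℂ => (1 : ℝ)) (by fun_prop)
    rw [Real.circleAverage_const] at this
    simpa using this
  calc _ ≤ ∫ ζ, (2 * Real.log 2 - Real.log ‖ζ - a‖) ∂circleMeasure :=
        integral_mono_ae (integrable_log_norm_sub a).norm
          ((integrable_const _).sub (integrable_log_norm_sub a)) h1
    _ = 2 * Real.log 2 := by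
        rw [integral_sub (integrable_const _) (integrable_log_norm_sub a), h0]
        simp [hm]

/-- The Schwarz integral formula on the unit disc for a function with `f 0 = 0`. -/
theorem circleAverage_schwarz {f : ℂ → ℂ} (hf : DiffContOnCl ℂ f (Metric.ball 0 1)) (h0 : f 0 = 0)
    {z : ℂ} (hz : z ∈ Metric.ball (0 : ℂ) 1) :
    Real.circleAverage (fun ζ => (ζ + z) / (ζ - z) * ((f ζ).re : ℂ)) 0 1 = f z := by
  have hz' : ‖z‖ < 1 := by simpa using hz
  have hfc : ContinuousOn f (Metric.sphere 0 1) := by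
    have := hf.2
    rw [closure_ball 0 one_ne_zero] at this
    exact this.mono Metric.sphere_subset_closedBall
  have hne : ∀ ζ ∈ Metric.sphere (0 : ℂ) 1, ζ - z ≠ 0 := by
    intro ζ hζ h
    rw [sub_eq_zero] at h
    rw [mem_sphere_zero_iff_norm, h] at hζ
    linarith
  have hne2 : ∀ ζ ∈ Metric.closedBall (0 : ℂ) 1, 1 - (starRingEnd ℂ) z * ζ ≠ 0 := by
    intro ζ hζ h
    have h1 : ‖(starRingEnd ℂ) z * ζ‖ < 1 := by
      rw [norm_mul, RCLike.norm_conj]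
      have : ‖ζ‖ ≤ 1 := by simpa using hζ
      nlinarith [norm_nonneg z, norm_nonneg ζ]
    rw [sub_eq_zero] at h
    rw [← h] at h1
    simp at h1
  have e1 : Real.circleAverage (fun ζ => (ζ / (ζ - z)) * f ζ) 0 1 = f z := by
    have := DiffContOnCl.circleAverage_smul_div (R := 1) (c := 0) (f := f) (w := z)
      (by simpa using hf) (by simpa using hz)
    simpa using this
  have e2 : Real.circleAverage f 0 1 = 0 := by
    have := DiffContOnCl.circleAverage (R := 1) (c := 0) (f := f) (by simpa using hf)
    rw [this, h0]
  have e3 : Real.circleAverage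
      (fun ζ => (1 + (starRingEnd ℂ) z * ζ) / (1 - (starRingEnd ℂ) z * ζ) * f ζ) 0 1 = 0 := by
    have hd : DifferentiableOn ℂ
        (fun ζ => (1 + (starRingEnd ℂ) z * ζ) / (1 - (starRingEnd ℂ) z * ζ))
        (closure (Metric.ball 0 1)) := by
      rw [closure_ball 0 one_ne_zero]
      exact DifferentiableOn.div (by fun_prop) (by fun_prop) hne2
    have := DiffContOnCl.circleAverage (R := 1) (c := 0)
      (f := fun ζ => ((1 + (starRingEnd ℂ) z * ζ) / (1 - (starRingEnd ℂ) z * ζ)) • f ζ)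
      (by simpa only [abs_one] using hd.diffContOnCl.smul hf)
    simpa [h0] using this
  have e4 : Real.circleAverage (fun ζ => (starRingEnd ℂ)
      ((1 + (starRingEnd ℂ) z * ζ) / (1 - (starRingEnd ℂ) z * ζ) * f ζ)) 0 1 = 0 := by
    have hi : CircleIntegrable
        (fun ζ => (1 + (starRingEnd ℂ) z * ζ) / (1 - (starRingEnd ℂ) z * ζ) * f ζ) 0 1 := by
      refine ContinuousOn.circleIntegrable zero_le_one (ContinuousOn.mul ?_ hfc)
      exact ContinuousOn.div (by fun_prop) (by fun_prop)
        fun ζ hζ => hne2 ζ (Metric.sphere_subset_closedBall hζ)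
    have := (conjCLE : ℂ →L[ℝ] ℂ).circleAverage_comp_comm hi
    rw [e3, map_zero] at this
    exact this
  have hc : ContinuousOn (fun ζ => ζ / (ζ - z)) (Metric.sphere (0 : ℂ) 1) :=
    ContinuousOn.div (by fun_prop) (by fun_prop) hne
  -- Write `Re f = (f + conj f) / 2` and `(ζ + z) / (ζ - z) = 2 ζ / (ζ - z) - 1`. On the circle
  -- `conj ζ = 1 / ζ`, so the kernel is the conjugate of a function holomorphic on the closed disc.
  -- The averages of the three terms are then `f z`, `0` and `0`, the last two because `f 0 = 0`.
  have key : EqOn (fun ζ => (ζ + z) / (ζ - z) * ((f ζ).re : ℂ))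
      (fun ζ => ((ζ / (ζ - z)) * f ζ + (2⁻¹ : ℂ) • (-f ζ)) + (2⁻¹ : ℂ) • ((starRingEnd ℂ)
      ((1 + (starRingEnd ℂ) z * ζ) / (1 - (starRingEnd ℂ) z * ζ) * f ζ)))
      (Metric.sphere 0 |1|) := by
    intro ζ hζ
    rw [abs_one] at hζ
    have h1 := hne ζ hζ
    have hn : ζ * (starRingEnd ℂ) ζ = 1 := by
      rw [mul_conj, normSq_eq_norm_sq, mem_sphere_zero_iff_norm.1 hζ]; simp
    have h2 : (starRingEnd ℂ) ζ ≠ 0 := fun h => by simp [h] at hn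
    have h3 : (1 + z * (starRingEnd ℂ) ζ) / (1 - z * (starRingEnd ℂ) ζ) = (ζ + z) / (ζ - z) := by
      rw [← hn, show ζ * (starRingEnd ℂ) ζ + z * (starRingEnd ℂ) ζ =
        (ζ + z) * (starRingEnd ℂ) ζ by ring, show ζ * (starRingEnd ℂ) ζ - z * (starRingEnd ℂ) ζ =
        (ζ - z) * (starRingEnd ℂ) ζ by ring, mul_div_mul_right _ _ h2]
    simp only [map_mul, map_div₀, map_add, map_sub, map_one, conj_conj, h3, smul_eq_mul]
    have h4 : ((f ζ).re : ℂ) = (f ζ + (starRingEnd ℂ) (f ζ)) / 2 := by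
      rw [add_conj]; push_cast; ring
    rw [h4]
    field_simp
    ring
  rw [Real.circleAverage_congr_sphere key, Real.circleAverage_fun_add, Real.circleAverage_fun_add,
    Real.circleAverage_fun_smul, Real.circleAverage_fun_smul, e4, e1]
  · have : Real.circleAverage (fun ζ => -f ζ) 0 1 = 0 := by
      have := Real.circleAverage_fun_smul (a := (-1 : ℂ)) (f := f) (c := 0) (R := 1)
      simpa [e2] using this
    simp [this]
  · exact ContinuousOn.circleIntegrable zero_le_one (hc.mul hfc)
  · exact ContinuousOn.circleIntegrable zero_le_one (by fun_prop)
  · exact ContinuousOn.circleIntegrable zero_le_one ((hc.mul hfc).add (by fun_prop))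
  · refine ContinuousOn.circleIntegrable zero_le_one ?_
    refine ContinuousOn.const_smul (Continuous.comp_continuousOn (g := starRingEnd ℂ)
      continuous_conj (ContinuousOn.mul ?_ hfc)) (2⁻¹ : ℂ)
    exact ContinuousOn.div (by fun_prop) (by fun_prop)
        fun ζ hζ => hne2 ζ (Metric.sphere_subset_closedBall hζ)

/-- `1 - conj a * z` is an outer function when `|a| = 1`. -/
theorem exp_integral_log_norm_sub {a : ℂ} (ha : ‖a‖ = 1) {z : ℂ} (hz : z ∈ Metric.ball (0 : ℂ) 1) :
    exp (∫ ζ, (ζ + z) / (ζ - z) * (Real.log ‖ζ - a‖ : ℂ) ∂circleMeasure) =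
      1 - (starRingEnd ℂ) a * z := by
  have hz' : ‖z‖ < 1 := by simpa using hz
  have hsl : ∀ {r : ℝ}, 0 < r → r < 1 → ∀ {w : ℂ}, ‖w‖ ≤ 1 →
      1 - r * (starRingEnd ℂ) a * w ∈ slitPlane := by
    intro r h0 h1 w hw
    rw [sub_eq_add_neg]
    refine mem_slitPlane_of_norm_lt_one ?_
    rw [norm_neg, norm_mul, norm_mul, RCLike.norm_conj, ha, norm_real, Real.norm_eq_abs,
      abs_of_pos h0]
    nlinarith [norm_nonneg w]
  -- After dilation by `r < 1` the logarithm is holomorphic on the closed disc and vanishes at `0`,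
  -- so the Schwarz formula applies; then `r → 1`.
  have hr : ∀ {r : ℝ}, 0 < r → r < 1 →
      ∫ ζ, (ζ + z) / (ζ - z) * (Real.log ‖1 - r * (starRingEnd ℂ) a * ζ‖ : ℂ) ∂circleMeasure =
      log (1 - r * (starRingEnd ℂ) a * z) := by
    intro r h0 h1
    rw [integral_circleMeasure (Measurable.aestronglyMeasurable (by fun_prop))]
    have hd : DifferentiableOn ℂ (fun w => log (1 - r * (starRingEnd ℂ) a * w))
        (closure (Metric.ball 0 1)) := by
      rw [closure_ball 0 one_ne_zero]
      exact DifferentiableOn.clog (by fun_prop) fun w hw => hsl h0 h1 (by simpa using hw)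
    have := circleAverage_schwarz hd.diffContOnCl (by simp) hz
    simpa only [log_re] using this
  have hlim : Tendsto (fun r : ℝ =>
      ∫ ζ, (ζ + z) / (ζ - z) * (Real.log ‖1 - r * (starRingEnd ℂ) a * ζ‖ : ℂ) ∂circleMeasure)
      (𝓝[<] 1) (𝓝 (∫ ζ, (ζ + z) / (ζ - z) * (Real.log ‖ζ - a‖ : ℂ) ∂circleMeasure)) := by
    have hia : ∀ ζ : ℂ, ‖ζ‖ = 1 → ‖ζ - a‖ = ‖1 - (starRingEnd ℂ) a * ζ‖ := by
      intro ζ hζ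
      have h : a * (starRingEnd ℂ) a = 1 := by
        rw [mul_conj, normSq_eq_norm_sq, ha]; simp
      rw [norm_sub_rev, show a - ζ = a * (1 - (starRingEnd ℂ) a * ζ) by linear_combination ζ * h,
        norm_mul, ha, one_mul]
    refine tendsto_integral_filter_of_dominated_convergence
      (fun ζ => 2 / (1 - ‖z‖) * (Real.log 2 + ‖Real.log ‖ζ - a‖‖)) ?_ ?_ ?_ ?_
    · exact Eventually.of_forall fun r => Measurable.aestronglyMeasurable (by fun_prop)
    · filter_upwards [Ioo_mem_nhdsLT (zero_lt_one' ℝ)] with r hr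
      filter_upwards [ae_circleMeasure_norm_eq_one, ae_circleMeasure_ne a] with ζ hζ hζa
      have hk : ‖(ζ + z) / (ζ - z)‖ ≤ 2 / (1 - ‖z‖) := by
        rw [norm_div]
        refine div_le_div₀ (by norm_num) ?_ (by linarith) ?_
        · exact (norm_add_le _ _).trans (by rw [hζ]; linarith)
        · have := norm_sub_norm_le ζ z
          rwa [hζ] at this
      rw [norm_mul, norm_real]
      refine mul_le_mul hk ?_ (norm_nonneg _) (div_nonneg (by norm_num) (by linarith))
      set w := (starRingEnd ℂ) a * ζ with hw
      have hwn : ‖w‖ = 1 := by rw [hw, norm_mul, RCLike.norm_conj, ha, hζ, one_mul]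
      rw [hia ζ hζ, ← hw, mul_assoc, ← hw]
      have hrw : ‖(r : ℂ) * w‖ = r := by
        rw [norm_mul, hwn, norm_real, Real.norm_eq_abs, abs_of_pos hr.1, mul_one]
      have hlow : 1 - r ≤ ‖1 - (r : ℂ) * w‖ := by
        have := norm_sub_norm_le (1 : ℂ) (r * w)
        rwa [hrw, norm_one] at this
      have hup : ‖1 - (r : ℂ) * w‖ ≤ 2 := by
        refine (norm_sub_le _ _).trans ?_
        rw [hrw, norm_one]; linarith [hr.2]
      -- Since `1 - r ≤ |1 - r w|`, the dilated logarithm is bounded below by the undilated one up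
      -- to `log 2`; this gives an integrable majorant independent of `r`.
      have hcmp : ‖1 - w‖ ≤ 2 * ‖1 - (r : ℂ) * w‖ := by
        have h1 : ‖1 - w‖ ≤ ‖1 - (r : ℂ) * w‖ + ‖((r : ℂ) - 1) * w‖ := by
          rw [show 1 - w = (1 - (r : ℂ) * w) + ((r : ℂ) - 1) * w by ring]
          exact norm_add_le _ _
        have h2 : ‖((r : ℂ) - 1) * w‖ = 1 - r := by
          rw [norm_mul, hwn, mul_one, ← ofReal_one, ← ofReal_sub, norm_real, Real.norm_eq_abs,
            abs_of_neg (by linarith [hr.2])]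
          ring
        linarith
      have hpos : 0 < ‖1 - (r : ℂ) * w‖ := by linarith [hr.2]
      have hlog2 : 0 ≤ Real.log 2 := Real.log_nonneg (by norm_num)
      rw [Real.norm_eq_abs, Real.norm_eq_abs, abs_le]
      constructor
      · have h : 0 < ‖1 - w‖ := by
          rw [hw, ← hia ζ hζ]
          exact norm_pos_iff.2 (sub_ne_zero.2 hζa)
        have := Real.log_le_log h hcmp
        rw [Real.log_mul (by norm_num) hpos.ne'] at this
        linarith [neg_abs_le (Real.log ‖1 - w‖)]
      · linarith [Real.log_le_log hpos hup, abs_nonneg (Real.log ‖1 - w‖)]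
    · exact ((integrable_const _).add (integrable_log_norm_sub a).norm).const_mul _
    · filter_upwards [ae_circleMeasure_norm_eq_one, ae_circleMeasure_ne a] with ζ hζ hζa
      have h1 : Continuous fun r : ℝ => ‖1 - r * (starRingEnd ℂ) a * ζ‖ := by fun_prop
      have h2 := h1.tendsto 1
      have h3 : ‖1 - ((1 : ℝ) : ℂ) * (starRingEnd ℂ) a * ζ‖ = ‖ζ - a‖ := by
        rw [hia ζ hζ, ofReal_one, one_mul]
      rw [h3] at h2
      have h4 := ((continuous_ofReal.tendsto _).comp
        (h2.log (norm_ne_zero_iff.2 (sub_ne_zero.2 hζa)))).const_mul ((ζ + z) / (ζ - z))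
      exact h4.mono_left nhdsWithin_le_nhds
  have hlim2 : Tendsto (fun r : ℝ => 1 - r * (starRingEnd ℂ) a * z) (𝓝[<] 1)
      (𝓝 (1 - (starRingEnd ℂ) a * z)) := by
    have : Continuous fun r : ℝ => 1 - r * (starRingEnd ℂ) a * z := by fun_prop
    have := this.tendsto 1
    simp only [ofReal_one, one_mul] at this
    exact this.mono_left nhdsWithin_le_nhds
  refine tendsto_nhds_unique (((continuous_exp.tendsto _).comp hlim)) (hlim2.congr' ?_)
  filter_upwards [Ioo_mem_nhdsLT (zero_lt_one' ℝ)] with r hrr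
  rw [Function.comp_apply, hr hrr.1 hrr.2,
    exp_log (slitPlane_ne_zero (hsl hrr.1 hrr.2 hz'.le))]

end BeurlingCarleson

/-! ### Herglotz integrals near circle points away from their mass. -/

namespace BeurlingCarleson

/-- The Herglotz integral `∫ (ζ + z) / (ζ - z) v(ζ) dμ(ζ)`. -/
noncomputable def herglotz (μ : Measure ℂ) (v : ℂ → ℝ) (z : ℂ) : ℂ :=
  ∫ ζ, (ζ + z) / (ζ - z) * (v ζ : ℂ) ∂μ

/-- The measure `v dμ` lives on the part of the unit circle at distance at least `δ` from `z₀`. -/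
def AwayFrom (μ : Measure ℂ) (v : ℂ → ℝ) (z₀ : ℂ) (δ : ℝ) : Prop :=
  ∀ᵐ ζ ∂μ, ‖ζ‖ = 1 ∧ (v ζ = 0 ∨ δ ≤ ‖ζ - z₀‖)

variable {μ : Measure ℂ} {v : ℂ → ℝ} {z₀ : ℂ} {δ : ℝ}

theorem integrable_kernel_mul {z : ℂ} {c : ℝ} (hc : 0 < c) (hv : Integrable v μ)
    (h : ∀ᵐ ζ ∂μ, ‖ζ‖ = 1 ∧ (v ζ = 0 ∨ c ≤ ‖ζ - z‖)) :
    Integrable (fun ζ => (ζ + z) / (ζ - z) * (v ζ : ℂ)) μ := by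
  refine Integrable.mono' (g := fun ζ => (1 + ‖z‖) / c * ‖v ζ‖) (hv.norm.const_mul _)
    (AEStronglyMeasurable.mul (Measurable.aestronglyMeasurable (by fun_prop))
      (continuous_ofReal.comp_aestronglyMeasurable hv.1)) ?_
  filter_upwards [h] with ζ hζ
  rw [norm_mul, norm_real]
  rcases hζ.2 with h0 | h1
  · simp [h0]
  · refine mul_le_mul_of_nonneg_right ?_ (norm_nonneg _)
    rw [norm_div]
    refine div_le_div₀ (by positivity) ?_ hc h1
    exact (norm_add_le _ _).trans (by rw [hζ.1])

theorem AwayFrom.shift (h : AwayFrom μ v z₀ δ) (z : ℂ) :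
    AwayFrom μ v z (δ - ‖z - z₀‖) := by
  filter_upwards [h] with ζ hζ
  refine ⟨hζ.1, hζ.2.imp_right fun h1 => ?_⟩
  have : ‖ζ - z₀‖ ≤ ‖ζ - z‖ + ‖z - z₀‖ := norm_sub_le_norm_sub_add_norm_sub _ _ _
  linarith

theorem differentiableOn_herglotz (hv : Integrable v μ) (h : AwayFrom μ v z₀ δ) :
    DifferentiableOn ℂ (herglotz μ v) (Metric.ball z₀ δ) := by
  intro z hz
  refine DifferentiableAt.differentiableWithinAt ?_
  have hz' : ‖z - z₀‖ < δ := by simpa [dist_eq_norm] using hz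
  -- Half of the remaining distance: every point of the `c`-ball about `z` still keeps distance `c`
  -- from the mass, which bounds the differentiated kernel.
  set c := (δ - ‖z - z₀‖) / 2 with hc
  have hc0 : 0 < c := by rw [hc]; linarith
  have hA : ∀ᵐ ζ ∂μ, ‖ζ‖ = 1 ∧ (v ζ = 0 ∨ ∀ x ∈ Metric.ball z c, c ≤ ‖ζ - x‖) := by
    filter_upwards [h.shift z] with ζ hζ
    refine ⟨hζ.1, hζ.2.imp_right fun h1 x hx => ?_⟩
    have h2 : ‖ζ - z‖ ≤ ‖ζ - x‖ + ‖x - z‖ := norm_sub_le_norm_sub_add_norm_sub _ _ _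
    have h3 : ‖x - z‖ < c := by simpa [dist_eq_norm] using hx
    linarith
  refine ((hasDerivAt_integral_of_dominated_loc_of_deriv_le
    (F' := fun x ζ => 2 * ζ / (ζ - x) ^ 2 * (v ζ : ℂ))
    (bound := fun ζ => 2 / c ^ 2 * ‖v ζ‖) (Metric.ball_mem_nhds z hc0) ?_ ?_ ?_ ?_ ?_ ?_).2
    ).differentiableAt
  · exact Eventually.of_forall fun x => AEStronglyMeasurable.mul
      (Measurable.aestronglyMeasurable (by fun_prop))
      (continuous_ofReal.comp_aestronglyMeasurable hv.1)
  · refine integrable_kernel_mul hc0 hv ?_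
    filter_upwards [hA] with ζ hζ
    exact ⟨hζ.1, hζ.2.imp_right fun h1 => h1 z (Metric.mem_ball_self hc0)⟩
  · exact AEStronglyMeasurable.mul (Measurable.aestronglyMeasurable (by fun_prop))
      (continuous_ofReal.comp_aestronglyMeasurable hv.1)
  · filter_upwards [hA] with ζ hζ x hx
    rw [norm_mul, norm_real]
    rcases hζ.2 with h0 | h1
    · simp [h0]
    · refine mul_le_mul_of_nonneg_right ?_ (norm_nonneg _)
      rw [norm_div, norm_mul, hζ.1, norm_pow, norm_ofNat, mul_one]
      have := h1 x hx
      gcongr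
  · exact hv.norm.const_mul _
  · filter_upwards [hA] with ζ hζ x hx
    rcases hζ.2 with h0 | h1
    · simp only [h0, ofReal_zero, mul_zero]
      exact hasDerivAt_const x 0
    · have hne : ζ - x ≠ 0 := norm_pos_iff.1 (hc0.trans_le (h1 x hx))
      have := ((hasDerivAt_id' x).const_add ζ).div ((hasDerivAt_id' x).const_sub ζ) hne
      refine (this.congr_deriv ?_).mul_const _
      congr 1
      ring

/-- The kernel difference is `2 ζ (z - z₀) / ((ζ - z)(ζ - z₀))`. Its numerator is at most `δ² / 2`
and its denominator at least `(δ / 2) δ`, so its modulus is at most `1`. This is why the radius must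
be quadratic in `δ`. -/
theorem norm_herglotz_sub_le (hv : Integrable v μ) (h : AwayFrom μ v z₀ δ) (hδ : 0 < δ)
    (hδ2 : δ ≤ 2) {z : ℂ} (hz : ‖z - z₀‖ ≤ δ ^ 2 / 4) :
    ‖herglotz μ v z - herglotz μ v z₀‖ ≤ ∫ ζ, ‖v ζ‖ ∂μ := by
  have hz2 : ‖z - z₀‖ ≤ δ / 2 := hz.trans (by nlinarith)
  have hzb : z ∈ Metric.ball z₀ δ := by
    rw [Metric.mem_ball, dist_eq_norm]; linarith
  have hi := integrable_kernel_mul (by linarith) hv (h.shift z)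
  have hi0 := integrable_kernel_mul hδ hv h
  rw [herglotz, herglotz, ← integral_sub hi hi0]
  refine norm_integral_le_of_norm_le hv.norm ?_
  filter_upwards [h, h.shift z] with ζ hζ hζ'
  rw [← sub_mul, norm_mul, norm_real]
  rcases hζ.2 with h0 | h1
  · simp [h0]
  rcases hζ'.2 with h0 | h2
  · simp [h0]
  refine mul_le_of_le_one_left (norm_nonneg _) ?_
  have h3 : ζ - z₀ ≠ 0 := norm_pos_iff.1 (by linarith)
  have h4 : ζ - z ≠ 0 := norm_pos_iff.1 (by linarith)
  have h5 : (ζ + z) / (ζ - z) - (ζ + z₀) / (ζ - z₀) =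
      2 * ζ * (z - z₀) / ((ζ - z) * (ζ - z₀)) := by
    field_simp
    ring
  rw [h5, norm_div, norm_mul, norm_mul, norm_mul, hζ.1, norm_ofNat,
    div_le_one (mul_pos (norm_pos_iff.2 h4) (norm_pos_iff.2 h3))]
  have h6 : δ / 2 ≤ ‖ζ - z‖ := by linarith
  nlinarith

/-- The real part of the kernel is the Poisson kernel, whose numerator `|ζ|² - |z₀|²` vanishes when
both points are on the circle. -/
theorem re_herglotz_eq_zero (hv : Integrable v μ) (h : AwayFrom μ v z₀ δ) (hδ : 0 < δ)
    (hz₀ : ‖z₀‖ = 1) : (herglotz μ v z₀).re = 0 := by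
  have hi := integrable_kernel_mul hδ hv h
  have h1 : (herglotz μ v z₀).re = ∫ ζ, ((ζ + z₀) / (ζ - z₀) * (v ζ : ℂ)).re ∂μ :=
    (integral_re hi).symm
  rw [h1]
  refine integral_eq_zero_of_ae ?_
  filter_upwards [h] with ζ hζ
  have h2 := congrFun (poissonKernel_eq_re_herglotzRieszKernel (c := 0) (w := z₀)) ζ
  simp only [poissonKernel_def, Function.comp_apply, herglotzRieszKernel_def, sub_zero, hζ.1,
    hz₀, sub_self, zero_div] at h2
  rw [re_mul_ofReal, ← h2, zero_mul]
  rfl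

theorem norm_exp_herglotz_le (hv : Integrable v μ) (h : AwayFrom μ v z₀ δ) (hδ : 0 < δ)
    (hδ2 : δ ≤ 2) (hz₀ : ‖z₀‖ = 1) {z : ℂ} (hz : ‖z - z₀‖ ≤ δ ^ 2 / 4) :
    ‖exp (herglotz μ v z)‖ ≤ Real.exp (∫ ζ, ‖v ζ‖ ∂μ) ∧
    ‖exp (-herglotz μ v z)‖ ≤ Real.exp (∫ ζ, ‖v ζ‖ ∂μ) := by
  have h1 := norm_herglotz_sub_le hv h hδ hδ2 hz
  have h2 := abs_re_le_norm (herglotz μ v z - herglotz μ v z₀)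
  rw [sub_re, re_herglotz_eq_zero hv h hδ hz₀, sub_zero] at h2
  have h3 := abs_le.1 (h2.trans h1)
  rw [norm_exp, norm_exp, neg_re]
  exact ⟨Real.exp_le_exp.2 h3.2, Real.exp_le_exp.2 (by linarith)⟩

/-- The exponent is purely imaginary, so conjugation is inversion. This replaces the antiholomorphic
factor `conj g₁` by a holomorphic one. -/
theorem conj_exp_neg_herglotz (hv : Integrable v μ) (h : AwayFrom μ v z₀ δ) (hδ : 0 < δ)
    (hz₀ : ‖z₀‖ = 1) :
    (starRingEnd ℂ) (exp (-herglotz μ v z₀)) = exp (herglotz μ v z₀) := by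
  have := re_herglotz_eq_zero hv h hδ hz₀
  rw [← exp_conj]
  congr 1
  apply Complex.ext <;> simp [this]

end BeurlingCarleson

/-! ### Gaps of the angle set, the function `phi`, and chordal distances. -/

namespace BeurlingCarleson

/-- The closed `2π`-periodic set of angles of points of `E`. -/
def angles (E : Set ℂ) : Set ℝ := {t | exp (t * I) ∈ E}

/-- `(α, β)` is a component of the complement of `angles E`. -/
structure IsGap (E : Set ℂ) (α β : ℝ) : Prop where
  lt : α < β
  left_mem : α ∈ angles E
  right_mem : β ∈ angles E
  notMem : ∀ t ∈ Ioo α β, t ∉ angles E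

variable {E : Set ℂ} {α β α' β' t : ℝ}

theorem isClosed_angles (hE : IsClosed E) : IsClosed (angles E) :=
  hE.preimage (by fun_prop)

theorem exp_add_int_mul_two_pi (t : ℝ) (j : ℤ) :
    exp (((t + j * (2 * Real.pi) : ℝ) : ℂ) * I) = exp (t * I) := by
  push_cast
  rw [show ((t : ℂ) + j * (2 * Real.pi)) * I = t * I + j * (2 * Real.pi * I) by ring, exp_add,
    exp_int_mul_two_pi_mul_I, mul_one]

theorem add_int_mul_two_pi_mem_angles_iff (j : ℤ) :
    t + j * (2 * Real.pi) ∈ angles E ↔ t ∈ angles E := by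
  simp only [angles, mem_ofPred_eq, exp_add_int_mul_two_pi]

theorem exists_int_of_exp_eq {s t : ℝ} (h : exp (s * I) = exp (t * I)) :
    ∃ j : ℤ, s = t + j * (2 * Real.pi) := by
  obtain ⟨j, hj⟩ := exp_eq_exp_iff_exists_int.1 h
  refine ⟨j, ?_⟩
  have h1 : ((s : ℂ)) = t + j * (2 * Real.pi) := by
    have : ((s : ℂ)) * I = (t + j * (2 * Real.pi)) * I := by rw [hj]; ring
    exact mul_right_cancel₀ I_ne_zero this
  exact_mod_cast h1

theorem IsGap.shift (h : IsGap E α β) (j : ℤ) :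
    IsGap E (α + j * (2 * Real.pi)) (β + j * (2 * Real.pi)) where
  lt := by linarith [h.lt]
  left_mem := (add_int_mul_two_pi_mem_angles_iff j).2 h.left_mem
  right_mem := (add_int_mul_two_pi_mem_angles_iff j).2 h.right_mem
  notMem t ht := by
    have := h.notMem (t - j * (2 * Real.pi)) ⟨by linarith [ht.1], by linarith [ht.2]⟩
    rwa [← add_int_mul_two_pi_mem_angles_iff j, sub_add_cancel] at this

theorem IsGap.le_of_mem (h : IsGap E α β) {s : ℝ} (hs : s ∈ angles E) (t : ℝ) :
    min (t - α) (β - t) ≤ |s - t| := by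
  by_contra hlt
  rw [not_le, abs_lt, lt_min_iff] at *
  obtain ⟨h1, h2⟩ := hlt
  exact h.notMem s ⟨by linarith [min_le_left (t - α) (β - t)],
    by linarith [min_le_right (t - α) (β - t)]⟩ hs

theorem IsGap.right_le (h : IsGap E α β) : β ≤ α + 2 * Real.pi := by
  by_contra hlt
  have := (add_int_mul_two_pi_mem_angles_iff 1).2 h.left_mem
  simp only [Int.cast_one, one_mul] at this
  exact h.notMem _ ⟨by linarith [Real.pi_pos], not_le.1 hlt⟩ this

/-- An endpoint of one gap cannot lie inside another. This makes `phi` independent of the arc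
selected by `choose`. -/
theorem IsGap.eq_of_mem (h : IsGap E α β) (h' : IsGap E α' β') (ht : t ∈ Ioo α β)
    (ht' : t ∈ Ioo α' β') : α = α' ∧ β = β' := by
  constructor
  · rcases lt_trichotomy α α' with hlt | heq | hlt
    · exact absurd h'.left_mem (h.notMem _ ⟨hlt, ht'.1.trans ht.2⟩)
    · exact heq
    · exact absurd h.left_mem (h'.notMem _ ⟨hlt, ht.1.trans ht'.2⟩)
  · rcases lt_trichotomy β β' with hlt | heq | hlt
    · exact absurd h.right_mem (h'.notMem _ ⟨ht'.1.trans ht.2, hlt⟩)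
    · exact heq
    · exact absurd h'.right_mem (h.notMem _ ⟨ht.1.trans ht'.2, hlt⟩)

/-- Periodicity puts points of the angle set on both sides of `t`; the nearest ones exist by
closedness and bound the gap. -/
theorem exists_isGap (hE : IsClosed E) (hne : (angles E).Nonempty) (ht : t ∉ angles E) :
    ∃ α β, IsGap E α β ∧ t ∈ Ioo α β := by
  obtain ⟨s, hs⟩ := hne
  have hK := isClosed_angles hE
  have h2 : 0 < 2 * Real.pi := by positivity
  have hL : (angles E ∩ Iic t).Nonempty := by
    refine ⟨s + (-⌈(s - t) / (2 * Real.pi)⌉ : ℤ) * (2 * Real.pi),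
      (add_int_mul_two_pi_mem_angles_iff _).2 hs, ?_⟩
    have := (div_le_iff₀ h2).1 (Int.le_ceil ((s - t) / (2 * Real.pi)))
    simp only [mem_Iic, Int.cast_neg]
    linarith
  have hR : (angles E ∩ Ici t).Nonempty := by
    refine ⟨s + (⌈(t - s) / (2 * Real.pi)⌉ : ℤ) * (2 * Real.pi),
      (add_int_mul_two_pi_mem_angles_iff _).2 hs, ?_⟩
    have := (div_le_iff₀ h2).1 (Int.le_ceil ((t - s) / (2 * Real.pi)))
    simp only [mem_Ici]
    linarith
  have hLb : BddAbove (angles E ∩ Iic t) := ⟨t, fun x hx => hx.2⟩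
  have hRb : BddBelow (angles E ∩ Ici t) := ⟨t, fun x hx => hx.2⟩
  have hα := (hK.inter isClosed_Iic).csSup_mem hL hLb
  have hβ := (hK.inter isClosed_Ici).csInf_mem hR hRb
  have hα' : sSup (angles E ∩ Iic t) < t :=
    lt_of_le_of_ne hα.2 fun h => ht (h ▸ hα.1)
  have hβ' : t < sInf (angles E ∩ Ici t) :=
    lt_of_le_of_ne hβ.2 fun h => ht (h ▸ hβ.1)
  refine ⟨_, _, ⟨hα'.trans hβ', hα.1, hβ.1, fun x hx hxK => ?_⟩, hα', hβ'⟩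
  rcases le_total x t with h | h
  · exact absurd (le_csSup hLb ⟨hxK, h⟩) (not_le.2 hx.1)
  · exact absurd (csInf_le hRb ⟨hxK, h⟩) (not_le.2 hx.2)

/-- The length bound in `complementaryArcs` is automatic for gaps: `α + 2π` is again an angle of
`E`. -/
theorem mem_complementaryArcs_iff {p : ℝ × ℝ} :
    p ∈ complementaryArcs E ↔ (0 ≤ p.1 ∧ p.1 < 2 * Real.pi) ∧ IsGap E p.1 p.2 := by
  have hd : Disjoint (openArc p) E ↔ ∀ t ∈ Ioo p.1 p.2, t ∉ angles E := by
    rw [Set.disjoint_left, openArc, forall_mem_image]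
    rfl
  constructor
  · rintro ⟨h0, h1, h2, h3, h4, h5, h6⟩
    exact ⟨⟨h0, h1⟩, h2, h5, h6, hd.1 h4⟩
  · rintro ⟨⟨h0, h1⟩, h⟩
    exact ⟨h0, h1, h.lt, h.right_le, hd.2 h.notMem, h.left_mem, h.right_mem⟩

theorem IsGap.exists_complementaryArcs (h : IsGap E α β) :
    ∃ j : ℤ, (α + j * (2 * Real.pi), β + j * (2 * Real.pi)) ∈ complementaryArcs E := by
  have h2 : 0 < 2 * Real.pi := by positivity
  refine ⟨-⌊α / (2 * Real.pi)⌋, mem_complementaryArcs_iff.2 ⟨?_, h.shift _⟩⟩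
  have h3 := (le_div_iff₀ h2).1 (Int.floor_le (α / (2 * Real.pi)))
  have h4 := (div_lt_iff₀ h2).1 (Int.lt_floor_add_one (α / (2 * Real.pi)))
  push_cast
  constructor <;> linarith

theorem phi_eq_of_isGap (h : IsGap E α β) (ht : t ∈ Ioo α β) :
    phi E (exp (t * I)) =
      ‖exp (t * I) - exp (α * I)‖ * ‖exp (t * I) - exp (β * I)‖ := by
  have hex : ∃ p ∈ complementaryArcs E, exp (t * I) ∈ openArc p := by
    obtain ⟨j, hj⟩ := h.exists_complementaryArcs
    refine ⟨_, hj, t + j * (2 * Real.pi), ⟨?_, ?_⟩, exp_add_int_mul_two_pi t j⟩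
    · simpa using ht.1
    · simpa using ht.2
  rw [phi, dif_pos hex, norm_mul]
  obtain ⟨hp, s, hs, hst⟩ := hex.choose_spec
  obtain ⟨j, rfl⟩ := exists_int_of_exp_eq hst
  obtain ⟨e1, e2⟩ := (mem_complementaryArcs_iff.1 hp).2.eq_of_mem (h.shift j) hs
    ⟨by linarith [ht.1], by linarith [ht.2]⟩
  rw [e1, e2, exp_add_int_mul_two_pi, exp_add_int_mul_two_pi]

theorem phi_of_mem {ζ : ℂ} (h : ζ ∈ E) : phi E ζ = 1 := by
  rw [phi, dif_neg]
  rintro ⟨p, hp, hζ⟩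
  exact Set.disjoint_left.1 hp.2.2.2.2.1 hζ h

theorem norm_exp_sub_exp (s t : ℝ) : ‖exp (s * I) - exp (t * I)‖ = 2 * |Real.sin ((s - t) / 2)| := by
  have h : exp (s * I) - exp (t * I) = exp (t * I) * (exp (I * ((s - t : ℝ) : ℂ)) - 1) := by
    rw [mul_sub, ← exp_add, mul_one]
    congr 2
    push_cast
    ring
  rw [h, norm_mul, norm_exp_ofReal_mul_I, one_mul, norm_exp_I_mul_ofReal_sub_one, norm_mul,
    Real.norm_eq_abs, Real.norm_eq_abs]
  norm_num

theorem norm_exp_sub_exp_le (s t : ℝ) : ‖exp (s * I) - exp (t * I)‖ ≤ |s - t| := by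
  rw [norm_exp_sub_exp]
  have := Real.abs_sin_le_abs (x := (s - t) / 2)
  rw [abs_div, abs_two] at this
  linarith

theorem le_norm_exp_sub_exp {s t : ℝ} (h : |s - t| ≤ Real.pi) :
    2 / Real.pi * |s - t| ≤ ‖exp (s * I) - exp (t * I)‖ := by
  rw [norm_exp_sub_exp]
  have := Real.mul_abs_le_abs_sin (x := (s - t) / 2) (by rw [abs_div, abs_two]; linarith)
  rw [abs_div, abs_two] at this
  linarith

theorem exists_angle_near {ζ : ℂ} (hζ : ‖ζ‖ = 1) (t : ℝ) :
    ∃ s : ℝ, |s - t| ≤ Real.pi ∧ exp (s * I) = ζ := by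
  refine ⟨t + arg (ζ * exp (-(t * I))), ?_, ?_⟩
  · rw [add_sub_cancel_left]; exact abs_arg_le_pi _
  · have hn : ‖ζ * exp (-(t * I))‖ = 1 := by
      rw [norm_mul, hζ, ← neg_mul, ← ofReal_neg, norm_exp_ofReal_mul_I, one_mul]
    have := norm_mul_exp_arg_mul_I (ζ * exp (-(t * I)))
    rw [hn, ofReal_one, one_mul] at this
    rw [ofReal_add, add_mul, exp_add, this, mul_comm, mul_assoc, ← exp_add]
    simp

/-- Chordal distance from a point of an arc to a point outside that arc. -/
theorem le_norm_sub_exp_of_notMem_openArc {ζ : ℂ} (hζ : ‖ζ‖ = 1) (hn : ζ ∉ openArc (α, β)) :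
    2 / Real.pi * min (t - α) (β - t) ≤ ‖ζ - exp (t * I)‖ := by
  obtain ⟨s, hs, rfl⟩ := exists_angle_near hζ t
  refine le_trans ?_ (le_norm_exp_sub_exp hs)
  refine mul_le_mul_of_nonneg_left ?_ (by positivity)
  by_contra hlt
  rw [not_le, lt_min_iff, abs_lt, abs_lt] at hlt
  exact hn ⟨s, ⟨by linarith [hlt.1.1], by linarith [hlt.2.2]⟩, rfl⟩

theorem IsGap.notMem_openArc (h : IsGap E α β) {ζ : ℂ} (hζ : ζ ∈ E) : ζ ∉ openArc (α, β) := by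
  rintro ⟨s, hs, rfl⟩
  exact h.notMem s hs hζ

end BeurlingCarleson

/-! ### Integrability of `log φ`. -/

namespace BeurlingCarleson

variable {E : Set ℂ} {α β α' β' t : ℝ}

theorem IsGap.phi_factors_pos (h : IsGap E α β) (ht : t ∈ Ioo α β) :
    0 < ‖exp (t * I) - exp (α * I)‖ ∧ 0 < ‖exp (t * I) - exp (β * I)‖ := by
  have hd : 0 < 2 / Real.pi * min (t - α) (β - t) :=
    mul_pos (by positivity) (lt_min (by linarith [ht.1]) (by linarith [ht.2]))
  rw [norm_sub_rev, norm_sub_rev _ (exp (β * I))]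
  exact ⟨hd.trans_le (le_norm_sub_exp_of_notMem_openArc (norm_exp_ofReal_mul_I α)
      (h.notMem_openArc h.left_mem)),
    hd.trans_le (le_norm_sub_exp_of_notMem_openArc (norm_exp_ofReal_mul_I β)
      (h.notMem_openArc h.right_mem))⟩

theorem log_phi_eq_of_isGap (h : IsGap E α β) (ht : t ∈ Ioo α β) :
    Real.log (phi E (exp (t * I))) =
      Real.log ‖exp (t * I) - exp (α * I)‖ + Real.log ‖exp (t * I) - exp (β * I)‖ := by
  rw [phi_eq_of_isGap h ht, Real.log_mul (h.phi_factors_pos ht).1.ne' (h.phi_factors_pos ht).2.ne']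

/-- Although `phi` is defined by choice, `log φ` is locally an explicit continuous function on the
open complement of the angles and is zero on the closed set of angles. -/
theorem measurable_log_phi_exp (hE : IsClosed E) :
    Measurable fun t : ℝ => Real.log (phi E (exp (t * I))) := by
  classical
  rcases (angles E).eq_empty_or_nonempty with he | hne
  · have : (fun t : ℝ => Real.log (phi E (exp (t * I)))) = fun _ => 0 := by
      funext t
      rw [phi, dif_neg, Real.log_one]
      rintro ⟨p, hp, -⟩
      have := (mem_complementaryArcs_iff.1 hp).2.left_mem
      rw [he] at this
      exact this
    rw [this]
    exact measurable_const
  have hK := isClosed_angles hE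
  have hc : ContinuousOn (fun t : ℝ => Real.log (phi E (exp (t * I)))) (angles E)ᶜ := by
    intro t ht
    obtain ⟨α, β, h, htI⟩ := exists_isGap hE hne ht
    refine ContinuousAt.continuousWithinAt (ContinuousAt.congr (f := fun t : ℝ =>
      Real.log ‖exp (t * I) - exp (α * I)‖ + Real.log ‖exp (t * I) - exp (β * I)‖) ?_ ?_)
    · refine ContinuousAt.add (ContinuousAt.log (by fun_prop) (h.phi_factors_pos htI).1.ne')
        (ContinuousAt.log (by fun_prop) (h.phi_factors_pos htI).2.ne')
    · filter_upwards [Ioo_mem_nhds htI.1 htI.2] with s hs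
      exact (log_phi_eq_of_isGap h hs).symm
  have := hc.measurable_piecewise (g := fun _ => (0 : ℝ)) continuousOn_const
    hK.measurableSet.compl
  convert this using 1
  funext t
  by_cases ht : t ∈ angles E
  · rw [piecewise_eq_of_notMem _ _ _ (by simpa using ht), phi_of_mem (E := E) ht, Real.log_one]
  · rw [piecewise_eq_of_mem _ _ _ (by simpa using ht)]

theorem aestronglyMeasurable_log_phi (hE : IsClosed E) :
    AEStronglyMeasurable (fun ζ => Real.log (phi E ζ)) circleMeasure := by
  refine ⟨_, ((measurable_log_phi_exp hE).comp measurable_arg).stronglyMeasurable, ?_⟩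
  filter_upwards [ae_circleMeasure_norm_eq_one] with ζ hζ
  have := norm_mul_exp_arg_mul_I ζ
  rw [hζ, ofReal_one, one_mul] at this
  rw [Function.comp_apply, this]

theorem abs_log_le_of_le_of_le {c d : ℝ} (hd : 0 < d) (h1 : 2 / Real.pi * d ≤ c) (h2 : c ≤ 2) :
    |Real.log c| ≤ Real.log 2 + Real.log Real.pi + |Real.log d| := by
  have hp : 0 < 2 / Real.pi * d := by positivity
  have h3 := Real.log_le_log hp h1
  have h4 := Real.log_le_log (hp.trans_le h1) h2
  rw [Real.log_mul (by positivity) hd.ne', Real.log_div (by norm_num) Real.pi_pos.ne'] at h3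
  have h5 : 0 ≤ Real.log 2 := Real.log_nonneg (by norm_num)
  have h6 : 0 ≤ Real.log Real.pi := Real.log_nonneg (by linarith [Real.pi_gt_three])
  rw [abs_le]
  constructor <;> linarith [neg_abs_le (Real.log d), abs_nonneg (Real.log d)]

theorem IsGap.abs_log_phi_le (h : IsGap E α β) (ht : t ∈ Ioo α β) :
    |Real.log (phi E (exp (t * I)))| ≤ 2 * (Real.log 2 + Real.log Real.pi) +
      2 * (|Real.log (t - α)| + |Real.log (β - t)|) := by
  have h1 : 0 < t - α := by linarith [ht.1]
  have h2 : 0 < β - t := by linarith [ht.2]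
  have hd : 0 < min (t - α) (β - t) := lt_min h1 h2
  have hlog : |Real.log (min (t - α) (β - t))| ≤ |Real.log (t - α)| + |Real.log (β - t)| := by
    rcases min_choice (t - α) (β - t) with h | h <;> rw [h] <;>
      linarith [abs_nonneg (Real.log (t - α)), abs_nonneg (Real.log (β - t))]
  have hle : ∀ s : ℝ, ‖exp (s * I) - exp (t * I)‖ ≤ 2 := fun s => by
    refine (norm_sub_le _ _).trans ?_
    rw [norm_exp_ofReal_mul_I, norm_exp_ofReal_mul_I]; norm_num
  rw [log_phi_eq_of_isGap h ht, norm_sub_rev, norm_sub_rev _ (exp (β * I))]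
  have a1 := abs_log_le_of_le_of_le hd (le_norm_sub_exp_of_notMem_openArc (norm_exp_ofReal_mul_I α)
      (h.notMem_openArc h.left_mem)) (hle α)
  have a2 := abs_log_le_of_le_of_le hd (le_norm_sub_exp_of_notMem_openArc (norm_exp_ofReal_mul_I β)
      (h.notMem_openArc h.right_mem)) (hle β)
  refine (abs_add_le _ _).trans ?_
  linarith

/-- For `0 < x ≤ 2π` one has `|log x| ≤ 2 log (2π) - log x`, and the right side integrates
explicitly. The term `L log (1/L)` is the one summed in the Carleson condition. -/
theorem intervalIntegral_abs_log_le {L : ℝ} (hL : 0 < L) (hL2 : L ≤ 2 * Real.pi) :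
    ∫ x in (0 : ℝ)..L, |Real.log x| ≤
      (2 * Real.log (2 * Real.pi) + 1) * L + L * Real.log (1 / L) := by
  have hi : IntervalIntegrable (fun x : ℝ => Real.log x) volume 0 L :=
    intervalIntegral.intervalIntegrable_log'
  calc ∫ x in (0 : ℝ)..L, |Real.log x|
      ≤ ∫ x in (0 : ℝ)..L, (2 * Real.log (2 * Real.pi) - Real.log x) := by
        refine intervalIntegral.integral_mono_on_of_le_Ioo hL.le hi.abs
          (intervalIntegrable_const.sub hi) fun x hx => ?_
        have h1 := Real.log_le_log hx.1 (hx.2.le.trans hL2)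
        have h2 : 0 ≤ Real.log (2 * Real.pi) := Real.log_nonneg (by linarith [Real.pi_gt_three])
        rw [abs_le]
        constructor <;> linarith
    _ = _ := by
        rw [intervalIntegral.integral_sub intervalIntegrable_const hi, integral_log,
          intervalIntegral.integral_const, one_div, Real.log_inv]
        simp
        ring

theorem IsGap.integrableOn_log_phi (hE : IsClosed E) (h : IsGap E α β) :
    IntegrableOn (fun t : ℝ => Real.log (phi E (exp (t * I)))) (Ioo α β) ∧
    ∫ t in Ioo α β, ‖Real.log (phi E (exp (t * I)))‖ ≤
      (2 * (Real.log 2 + Real.log Real.pi) + 4 * (2 * Real.log (2 * Real.pi) + 1)) * (β - α) +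
        4 * ((β - α) * Real.log (1 / (β - α))) := by
  have hL : 0 < β - α := by linarith [h.lt]
  have hl : ∀ a b : ℝ, IntervalIntegrable (fun x : ℝ => |Real.log x|) volume a b := fun a b =>
    (intervalIntegral.intervalIntegrable_log' (a := a) (b := b)).abs
  have i1 : IntervalIntegrable (fun x : ℝ => |Real.log (x - α)|) volume α β := by
    simpa using (hl 0 (β - α)).comp_sub_right α
  have i2 : IntervalIntegrable (fun x : ℝ => |Real.log (β - x)|) volume α β := by
    simpa using ((hl 0 (β - α)).comp_sub_left β).symm
  have hg : IntervalIntegrable (fun t : ℝ => 2 * (Real.log 2 + Real.log Real.pi) +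
      2 * (|Real.log (t - α)| + |Real.log (β - t)|)) volume α β :=
    intervalIntegrable_const.add ((i1.add i2).const_mul 2)
  have hg' := (intervalIntegrable_iff_integrableOn_Ioo_of_le h.lt.le).1 hg
  have hb : ∀ᵐ t : ℝ ∂volume.restrict (Ioo α β), ‖Real.log (phi E (exp (t * I)))‖ ≤
      2 * (Real.log 2 + Real.log Real.pi) + 2 * (|Real.log (t - α)| + |Real.log (β - t)|) := by
    filter_upwards [ae_restrict_mem measurableSet_Ioo] with t ht
    exact h.abs_log_phi_le ht
  have hf := hg'.mono' (measurable_log_phi_exp hE).aestronglyMeasurable hb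
  refine ⟨hf, (integral_mono_ae hf.norm hg' hb).trans ?_⟩
  rw [← integral_Ioc_eq_integral_Ioo, ← intervalIntegral.integral_of_le h.lt.le,
    intervalIntegral.integral_add intervalIntegrable_const ((i1.add i2).const_mul 2),
    intervalIntegral.integral_const_mul (2 : ℝ) (fun x => |Real.log (x - α)| + |Real.log (β - x)|),
    intervalIntegral.integral_add i1 i2,
    intervalIntegral.integral_comp_sub_right (fun x => |Real.log x|),
    intervalIntegral.integral_comp_sub_left (fun x => |Real.log x|),
    intervalIntegral.integral_const, sub_self, sub_self, smul_eq_mul]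
  have := intervalIntegral_abs_log_le hL (by linarith [h.right_le])
  linarith

theorem pairwise_disjoint_complementaryArcs :
    (complementaryArcs E).PairwiseDisjoint fun p => Ioo p.1 p.2 := by
  intro p hp q hq hne
  refine Set.disjoint_left.2 fun t ht ht' => hne ?_
  have := (mem_complementaryArcs_iff.1 hp).2.eq_of_mem (mem_complementaryArcs_iff.1 hq).2 ht ht'
  exact Prod.ext this.1 this.2

theorem countable_complementaryArcs : (complementaryArcs E).Countable :=
  pairwise_disjoint_complementaryArcs.countable_of_isOpen (fun _ _ => isOpen_Ioo)
    fun _ hp => nonempty_Ioo.2 (mem_complementaryArcs_iff.1 hp).2.lt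

/-- The normalized gaps are disjoint and all lie in `(0, 4π)`. -/
theorem summable_length_complementaryArcs :
    Summable fun p : complementaryArcs E => p.1.2 - p.1.1 := by
  have := countable_complementaryArcs (E := E).to_subtype
  have hi : IntegrableOn (fun _ : ℝ => (1 : ℝ))
      (⋃ p : complementaryArcs E, Ioo p.1.1 p.1.2) := by
    refine IntegrableOn.mono_set (t := Ioo 0 (4 * Real.pi)) (by simp [ENNReal.mul_lt_top_iff]) ?_
    refine iUnion_subset fun p t ht => ?_
    have hp := mem_complementaryArcs_iff.1 p.2
    exact ⟨hp.1.1.trans_lt ht.1, by linarith [ht.2, hp.1.2, hp.2.right_le]⟩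
  have h := (hasSum_integral_iUnion (fun p : complementaryArcs E => measurableSet_Ioo)
    (fun p q hpq => pairwise_disjoint_complementaryArcs p.2 q.2 (Subtype.coe_injective.ne hpq))
    hi).summable
  refine h.congr fun p => ?_
  have := (mem_complementaryArcs_iff.1 p.2).2.lt
  simp [this.le]

theorem integrable_log_phi (hE : IsBeurlingCarleson E) (hne : (angles E).Nonempty) :
    Integrable (fun ζ => Real.log (phi E ζ)) circleMeasure := by
  obtain ⟨hcl, -, hsum⟩ := hE
  rw [integrable_circleMeasure_iff (aestronglyMeasurable_log_phi hcl),
    ← circleIntegrable_iff_integrableOn (fun ζ => Real.log (phi E ζ))]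
  have := countable_complementaryArcs (E := E).to_subtype
  have hK := isClosed_angles hcl
  have h2 : 0 < 2 * Real.pi := by positivity
  have hU : IntegrableOn (fun t : ℝ => Real.log (phi E (exp (t * I))))
      (⋃ p : complementaryArcs E, Ioo p.1.1 p.1.2) := by
    have hp := fun p : complementaryArcs E =>
      (mem_complementaryArcs_iff.1 p.2).2.integrableOn_log_phi hcl
    refine integrableOn_iUnion_of_summable_integral_norm (fun p => (hp p).1) ?_
    refine Summable.of_nonneg_of_le (fun p => integral_nonneg fun _ => norm_nonneg _)
      (fun p => (hp p).2) ?_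
    exact (summable_length_complementaryArcs.mul_left _).add (hsum.mul_left 4)
  have h0 : IntegrableOn (fun t : ℝ => Real.log (phi E (exp (t * I)))) (angles E) := by
    refine (integrableOn_congr_fun (g := fun _ => (0 : ℝ)) (fun t ht => ?_) hK.measurableSet).2
      integrableOn_zero
    rw [phi_of_mem (E := E) ht, Real.log_one]
  obtain ⟨s, hs⟩ := hne
  have hL : (angles E ∩ Ici 0).Nonempty := by
    refine ⟨s + (⌈(0 - s) / (2 * Real.pi)⌉ : ℤ) * (2 * Real.pi),
      (add_int_mul_two_pi_mem_angles_iff _).2 hs, ?_⟩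
    have := (div_le_iff₀ h2).1 (Int.le_ceil ((0 - s) / (2 * Real.pi)))
    simp only [mem_Ici]
    linarith
  have hLb : BddBelow (angles E ∩ Ici 0) := ⟨0, fun x hx => hx.2⟩
  have hmem := (hK.inter isClosed_Ici).csInf_mem hL hLb
  -- The period window starts at a point of the angle set, so no gap straddles its left end.
  -- Minimality of `α₀` forces each gap meeting the window to have left endpoint in `[0, 2π)`, the
  -- normalization of `complementaryArcs`.
  set α₀ := sInf (angles E ∩ Ici 0) with hα₀
  have hshift : ∀ x ∈ angles E, α₀ ≤ x → x < α₀ + 2 * Real.pi → x < 2 * Real.pi := by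
    intro x hx h3 h4
    by_contra hlt
    have hx' : x - 2 * Real.pi ∈ angles E := by
      have := (add_int_mul_two_pi_mem_angles_iff (t := x) (-1)).2 hx
      simpa [sub_eq_add_neg] using this
    have := csInf_le hLb ⟨hx', by simp only [mem_Ici]; linarith⟩
    linarith
  have hcov : Ico α₀ (α₀ + 2 * Real.pi) ⊆
      (⋃ p : complementaryArcs E, Ioo p.1.1 p.1.2) ∪ angles E := by
    intro t ht
    by_cases htK : t ∈ angles E
    · exact Or.inr htK
    obtain ⟨α, β, h, htI⟩ := exists_isGap hcl ⟨s, hs⟩ htK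
    have hα : α₀ ≤ α := by
      by_contra hlt
      rcases ht.1.lt_or_eq with h5 | h5
      · exact h.notMem α₀ ⟨not_le.1 hlt, h5.trans htI.2⟩ hmem.1
      · exact htK (h5 ▸ hmem.1)
    refine Or.inl (mem_iUnion.2 ⟨⟨(α, β), mem_complementaryArcs_iff.2 ⟨⟨hmem.2.trans hα, ?_⟩, h⟩⟩,
      htI⟩)
    exact hshift α h.left_mem hα (htI.1.trans ht.2)
  have hper := (periodic_comp_exp fun ζ => Real.log (phi E ζ)).intervalIntegrable_iff
    (t₁ := 0) (t₂ := α₀)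
  rw [zero_add] at hper
  have hint := (intervalIntegrable_iff_integrableOn_Ico_of_le (by linarith)).2
    ((hU.union h0).mono_set hcov)
  simpa [CircleIntegrable, circleMap] using hper.2 hint

end BeurlingCarleson

/-! ### Gluing by zero, and continuation across a gap. -/

namespace BeurlingCarleson

/-- A function vanishing on a closed set `K`, smooth off `K`, whose derivatives off `K` are
dominated by the squared distance to `K`, is smooth. -/
theorem contDiff_of_norm_iteratedDeriv_le {K : Set ℝ} {F : ℝ → ℂ} {n : ℕ}
    (h0 : ∀ t ∈ K, F t = 0)
    (hd : ∀ k ≤ n, ∀ t ∉ K, DifferentiableAt ℝ (iteratedDeriv k F) t)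
    (hb : ∀ k ≤ n, ∃ C, 0 ≤ C ∧ ∀ t ∉ K, ∀ s ∈ K, ‖iteratedDeriv k F t‖ ≤ C * |t - s| ^ 2) :
    ContDiff ℝ n F := by
  have hder : ∀ k ≤ n, (∀ t ∈ K, iteratedDeriv k F t = 0) →
      ∀ s ∈ K, HasDerivAt (iteratedDeriv k F) 0 s := by
    intro k hk hz s hs
    obtain ⟨C, hC0, hC⟩ := hb k hk
    -- A function that is `O(|t - s|²)` at `s` has derivative zero there; this carries the vanishing
    -- on `K` from one order to the next.
    have hO : (iteratedDeriv k F) =O[𝓝 s] fun t => ‖t - s‖ ^ 2 := by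
      refine Asymptotics.IsBigO.of_bound C (Eventually.of_forall fun t => ?_)
      rw [norm_pow, norm_norm, Real.norm_eq_abs]
      by_cases ht : t ∈ K
      · rw [hz t ht, norm_zero]
        positivity
      · exact hC t ht s hs
    have := hO.hasFDerivAt (𝕜 := ℝ) one_lt_two
    simpa using this.hasDerivAt
  have hz : ∀ k ≤ n, ∀ t ∈ K, iteratedDeriv k F t = 0 := by
    intro k
    induction k with
    | zero => intro _ t ht; simpa using h0 t ht
    | succ k ih =>
      intro hk t ht
      rw [iteratedDeriv_succ]
      exact (hder k (by omega) (ih (by omega)) t ht).deriv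
  refine contDiff_of_differentiable_iteratedDeriv (n := (n : ℕ∞)) fun m hm t => ?_
  have hm' : m ≤ n := by exact_mod_cast hm
  by_cases ht : t ∈ K
  · exact (hder m hm' (hz m hm') t ht).differentiableAt
  · exact hd m hm' t ht

/-- A complex derivative restricts to the real one along the real axis, and openness of `U` keeps
the agreement valid near each point for the induction. It lets Cauchy's estimate for `G` bound the
derivatives of `F`. -/
theorem iteratedDeriv_eq_of_eq_ofReal {F : ℝ → ℂ} {G : ℂ → ℂ} {U : Set ℂ} (hU : IsOpen U)
    (hG : DifferentiableOn ℂ G U) (hFG : ∀ t : ℝ, (t : ℂ) ∈ U → F t = G t) (k : ℕ) :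
    DifferentiableOn ℂ (iteratedDeriv k G) U ∧
      ∀ t : ℝ, (t : ℂ) ∈ U → iteratedDeriv k F t = iteratedDeriv k G t ∧
        DifferentiableAt ℝ (iteratedDeriv k F) t := by
  have hstep : ∀ {F : ℝ → ℂ} {G : ℂ → ℂ}, DifferentiableOn ℂ G U →
      (∀ t : ℝ, (t : ℂ) ∈ U → F t = G t) → ∀ t : ℝ, (t : ℂ) ∈ U →
      HasDerivAt F (deriv G t) t := by
    intro F G hG hFG t ht
    have h1 := ((hG.differentiableAt (hU.mem_nhds ht)).hasDerivAt).comp_ofReal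
    refine h1.congr_of_eventuallyEq ?_
    filter_upwards [(continuous_ofReal.tendsto t).eventually (hU.mem_nhds ht)] with s hs
    exact hFG s hs
  induction k with
  | zero =>
    simp only [iteratedDeriv_zero]
    exact ⟨hG, fun t ht => ⟨hFG t ht, (hstep hG hFG t ht).differentiableAt⟩⟩
  | succ k ih =>
    simp only [iteratedDeriv_succ]
    have h1 := ih.1.deriv hU
    have h2 : ∀ t : ℝ, (t : ℂ) ∈ U → deriv (iteratedDeriv k F) t = deriv (iteratedDeriv k G) t :=
      fun t ht => (hstep ih.1 (fun s hs => (ih.2 s hs).1) t ht).deriv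
    exact ⟨h1, fun t ht => ⟨h2 t ht, (hstep h1 h2 t ht).differentiableAt⟩⟩

variable {E : Set ℂ} {α β t : ℝ}

/-- On the complementary arc from `e^{iα}` to `e^{iβ}` this function vanishes. -/
noncomputable def logRatio (E : Set ℂ) (α β : ℝ) (ζ : ℂ) : ℝ :=
  Real.log (phi E ζ) - Real.log ‖ζ - exp (α * I)‖ - Real.log ‖ζ - exp (β * I)‖

theorem integrable_logRatio (hφ : Integrable (fun ζ => Real.log (phi E ζ)) circleMeasure) :
    Integrable (logRatio E α β) circleMeasure :=
  (hφ.sub (integrable_log_norm_sub _)).sub (integrable_log_norm_sub _)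

theorem integral_norm_logRatio_le (hφ : Integrable (fun ζ => Real.log (phi E ζ)) circleMeasure) :
    ∫ ζ, ‖logRatio E α β ζ‖ ∂circleMeasure ≤
      ∫ ζ, ‖Real.log (phi E ζ)‖ ∂circleMeasure + 4 * Real.log 2 := by
  have ia := (integrable_log_norm_sub (exp (α * I))).norm
  have ib := (integrable_log_norm_sub (exp (β * I))).norm
  have iab : Integrable (fun ζ => ‖Real.log (phi E ζ)‖ + ‖Real.log ‖ζ - exp (α * I)‖‖)
      circleMeasure := hφ.norm.add ia
  calc _ ≤ ∫ ζ, (‖Real.log (phi E ζ)‖ + ‖Real.log ‖ζ - exp (α * I)‖‖ +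
        ‖Real.log ‖ζ - exp (β * I)‖‖) ∂circleMeasure := by
        refine integral_mono (integrable_logRatio hφ).norm (iab.add ib) fun ζ => ?_
        exact (norm_sub_le _ _).trans (add_le_add_left (norm_sub_le _ _) _)
    _ ≤ _ := by
        rw [integral_add iab ib, integral_add hφ.norm ia]
        have h1 := integral_norm_log_norm_sub_le (norm_exp_ofReal_mul_I α)
        have h2 := integral_norm_log_norm_sub_le (norm_exp_ofReal_mul_I β)
        linarith

theorem IsGap.awayFrom_logRatio (h : IsGap E α β) (t : ℝ) :
    AwayFrom circleMeasure (logRatio E α β) (exp (t * I))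
      (2 / Real.pi * min (t - α) (β - t)) := by
  filter_upwards [ae_circleMeasure_norm_eq_one] with ζ hζ
  refine ⟨hζ, ?_⟩
  by_cases hn : ζ ∈ openArc (α, β)
  · obtain ⟨s, hs, rfl⟩ := hn
    left
    rw [logRatio, log_phi_eq_of_isGap h hs]
    ring
  · exact Or.inr (le_norm_sub_exp_of_notMem_openArc hζ hn)

theorem IsGap.awayFrom_restrict (h : IsGap E α β) (hcl : IsClosed E)
    (hT : E ⊆ Metric.sphere 0 1) (ν : Measure ℂ) (t : ℝ) :
    AwayFrom (ν.restrict E) (fun _ => 1) (exp (t * I))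
      (2 / Real.pi * min (t - α) (β - t)) := by
  filter_upwards [ae_restrict_mem hcl.measurableSet] with ζ hζ
  have h1 : ‖ζ‖ = 1 := by simpa using hT hζ
  exact ⟨h1, Or.inr (le_norm_sub_exp_of_notMem_openArc h1 (h.notMem_openArc hζ))⟩

theorem singularExp_eq (E : Set ℂ) (ν : Measure ℂ) (z : ℂ) :
    singularExp E ν z = exp (-herglotz (ν.restrict E) (fun _ => 1) z) := by
  simp [singularExp, herglotz]

/-- Continuation of the outer function `s` across a complementary arc. -/
noncomputable def outerExtension (E : Set ℂ) (N : ℕ) (α β : ℝ) (z : ℂ) : ℂ :=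
  ((1 - (starRingEnd ℂ) (exp (α * I)) * z) * (1 - (starRingEnd ℂ) (exp (β * I)) * z) *
    exp (herglotz circleMeasure (logRatio E α β) z)) ^ N

/-- Adding back the two endpoint logarithms to `logRatio` recovers `log φ`, and each contributes its
explicit linear outer function. -/
theorem outerFunction_eq (hφ : Integrable (fun ζ => Real.log (phi E ζ)) circleMeasure) (N : ℕ)
    (α β : ℝ) {z : ℂ} (hz : z ∈ Metric.ball (0 : ℂ) 1) :
    outerFunction (fun ζ => phi E ζ ^ N) z = outerExtension E N α β z := by
  have hz' : ‖z‖ < 1 := by simpa using hz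
  have hint : ∀ {v : ℂ → ℝ}, Integrable v circleMeasure →
      Integrable (fun ζ => (ζ + z) / (ζ - z) * (v ζ : ℂ)) circleMeasure := by
    intro v hv
    refine integrable_kernel_mul (c := 1 - ‖z‖) (by linarith) hv ?_
    filter_upwards [ae_circleMeasure_norm_eq_one] with ζ hζ
    refine ⟨hζ, Or.inr ?_⟩
    have := norm_sub_norm_le ζ z
    rwa [hζ] at this
  have ha := hint (integrable_log_norm_sub (exp (α * I)))
  have hb := hint (integrable_log_norm_sub (exp (β * I)))
  have hab : Integrable (fun ζ => (ζ + z) / (ζ - z) * (Real.log ‖ζ - exp (α * I)‖ : ℂ) +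
      (ζ + z) / (ζ - z) * (Real.log ‖ζ - exp (β * I)‖ : ℂ)) circleMeasure := ha.add hb
  have hu := hint (integrable_logRatio (α := α) (β := β) hφ)
  rw [outerFunction, outerExtension, ← exp_integral_log_norm_sub (norm_exp_ofReal_mul_I α) hz,
    ← exp_integral_log_norm_sub (norm_exp_ofReal_mul_I β) hz, herglotz, ← exp_add, ← exp_add,
    ← integral_add ha hb, ← integral_add hab hu, ← exp_nat_mul, ← integral_const_mul]
  congr 2
  funext ζ
  rw [Real.log_pow, logRatio]
  push_cast
  ring

theorem boundaryValue_eq {f g : ℂ → ℂ} {ζ : ℂ} (hζ : ‖ζ‖ = 1)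
    (hfg : ∀ z ∈ Metric.ball (0 : ℂ) 1, f z = g z) (hg : ContinuousAt g ζ) :
    HasBoundaryValue f ζ ∧ boundaryValue f ζ = g ζ := by
  have hlim : Tendsto f (𝓝[Metric.ball 0 1] ζ) (𝓝 (g ζ)) := by
    refine (hg.mono_left nhdsWithin_le_nhds).congr' ?_
    filter_upwards [self_mem_nhdsWithin] with z hz
    exact (hfg z hz).symm
  have : (𝓝[Metric.ball (0 : ℂ) 1] ζ).NeBot := by
    rw [← mem_closure_iff_nhdsWithin_neBot, closure_ball 0 one_ne_zero]
    simp [hζ]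
  exact ⟨⟨_, hlim⟩, hlim.limUnder_eq⟩

theorem IsGap.chord_pos (ht : t ∈ Ioo α β) : 0 < 2 / Real.pi * min (t - α) (β - t) :=
  mul_pos (by positivity) (lt_min (by linarith [ht.1]) (by linarith [ht.2]))

theorem differentiableOn_singularExp (h : IsGap E α β) (hcl : IsClosed E)
    (hT : E ⊆ Metric.sphere 0 1) (ν : Measure ℂ) [IsFiniteMeasure ν] (t : ℝ) :
    DifferentiableOn ℂ (singularExp E ν)
      (Metric.ball (exp (t * I)) (2 / Real.pi * min (t - α) (β - t))) := by
  have := differentiableOn_herglotz (integrable_const (1 : ℝ)) (h.awayFrom_restrict hcl hT ν t)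
  exact (this.neg.cexp).congr fun z _ => singularExp_eq E ν z

theorem differentiableOn_outerExtension (h : IsGap E α β)
    (hφ : Integrable (fun ζ => Real.log (phi E ζ)) circleMeasure) (N : ℕ) (t : ℝ) :
    DifferentiableOn ℂ (outerExtension E N α β)
      (Metric.ball (exp (t * I)) (2 / Real.pi * min (t - α) (β - t))) := by
  have := differentiableOn_herglotz (integrable_logRatio hφ) (h.awayFrom_logRatio t)
  exact (DifferentiableOn.mul (by fun_prop) this.cexp).pow N

theorem cutoff_eq_of_isGap (h : IsGap E α β) (hcl : IsClosed E) (hT : E ⊆ Metric.sphere 0 1)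
    (hφ : Integrable (fun ζ => Real.log (phi E ζ)) circleMeasure) (N : ℕ)
    (ν₁ ν₂ : Measure ℂ) [IsFiniteMeasure ν₁] [IsFiniteMeasure ν₂] (ht : t ∈ Ioo α β) :
    (HasBoundaryValue (singularExp E ν₁) (exp (t * I)) ∧
      HasBoundaryValue (singularExp E ν₂) (exp (t * I)) ∧
      HasBoundaryValue (outerFunction fun ζ => phi E ζ ^ N) (exp (t * I))) ∧
    cutoff E (singularExp E ν₁) (singularExp E ν₂) (outerFunction fun ζ => phi E ζ ^ N)
      (exp (t * I)) =
      exp (herglotz (ν₁.restrict E) (fun _ => 1) (exp (t * I))) *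
      exp (-herglotz (ν₂.restrict E) (fun _ => 1) (exp (t * I))) *
      outerExtension E N α β (exp (t * I)) := by
  have hδ := IsGap.chord_pos ht
  have hn : ‖exp (t * I)‖ = 1 := norm_exp_ofReal_mul_I t
  have hmem := Metric.ball_mem_nhds (exp (t * I)) hδ
  have b₁ := boundaryValue_eq hn (fun _ _ => rfl)
    ((differentiableOn_singularExp h hcl hT ν₁ t).differentiableAt hmem).continuousAt
  have b₂ := boundaryValue_eq hn (fun _ _ => rfl)
    ((differentiableOn_singularExp h hcl hT ν₂ t).differentiableAt hmem).continuousAt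
  have b₃ := boundaryValue_eq (f := outerFunction fun ζ => phi E ζ ^ N) hn
    (fun _ hz => outerFunction_eq hφ N α β hz)
    ((differentiableOn_outerExtension h hφ N t).differentiableAt hmem).continuousAt
  refine ⟨⟨b₁.1, b₂.1, b₃.1⟩, ?_⟩
  have hmem' : exp (t * I) ∈ Metric.sphere (0 : ℂ) 1 \ E := ⟨by simp, h.notMem t ht⟩
  rw [cutoff, indicator_of_mem hmem', b₁.2, b₂.2, b₃.2, singularExp_eq,
    singularExp_eq, conj_exp_neg_herglotz (integrable_const (1 : ℝ))
      (h.awayFrom_restrict hcl hT ν₁ t) hδ hn]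

theorem norm_one_sub_conj_mul {a : ℂ} (ha : ‖a‖ = 1) (z : ℂ) :
    ‖1 - (starRingEnd ℂ) a * z‖ = ‖z - a‖ := by
  have h : a * (starRingEnd ℂ) a = 1 := by
    rw [mul_conj, normSq_eq_norm_sq, ha]; simp
  rw [norm_sub_rev z, show a - z = a * (1 - (starRingEnd ℂ) a * z) by linear_combination z * h,
    norm_mul, ha, one_mul]

theorem norm_exp_mul_I_sub_le {w : ℂ} (hw : ‖w - t‖ ≤ 1) :
    ‖exp (w * I) - exp (t * I)‖ ≤ 2 * ‖w - t‖ := by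
  have h : exp (w * I) - exp (t * I) = exp (t * I) * (exp ((w - t) * I) - 1) := by
    rw [mul_sub, ← exp_add, mul_one]
    congr 2
    ring
  have h1 : ‖(w - t) * I‖ = ‖w - t‖ := by rw [norm_mul, norm_I, mul_one]
  rw [h, norm_mul, norm_exp_ofReal_mul_I, one_mul, ← h1]
  exact norm_exp_sub_one_le (by rwa [h1])

/-- The factor of the nearer endpoint is at most `2 d` and the other at most `3`, whence `6 d`. The
exponential is bounded by the mass of `logRatio`, uniformly in the gap. -/
theorem norm_outerExtension_le (h : IsGap E α β)
    (hφ : Integrable (fun ζ => Real.log (phi E ζ)) circleMeasure) (N : ℕ) (ht : t ∈ Ioo α β)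
    {z : ℂ} (hz : ‖z - exp (t * I)‖ ≤ (2 / Real.pi * min (t - α) (β - t)) ^ 2 / 4) :
    ‖outerExtension E N α β z‖ ≤
      (6 * min (t - α) (β - t) *
        Real.exp (∫ ζ, ‖Real.log (phi E ζ)‖ ∂circleMeasure + 4 * Real.log 2)) ^ N := by
  have hδ := IsGap.chord_pos ht
  set d := min (t - α) (β - t) with hd
  set δ := 2 / Real.pi * d with hδd
  have hdpi : d ≤ Real.pi := by
    linarith [min_le_left (t - α) (β - t), min_le_right (t - α) (β - t), h.right_le]
  have hπ := Real.pi_gt_three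
  have hδ2 : δ ≤ 2 := by
    rw [hδd, div_mul_eq_mul_div, div_le_iff₀ Real.pi_pos]; linarith
  have hδd' : δ ≤ d := by
    have hd0 : 0 < d := pos_of_mul_pos_right hδ (by positivity)
    rw [hδd, div_mul_eq_mul_div, div_le_iff₀ Real.pi_pos]
    nlinarith
  have hz1 : ‖z - exp (t * I)‖ ≤ d := hz.trans (by nlinarith)
  have hz2 : ‖z - exp (t * I)‖ ≤ 1 := hz.trans (by nlinarith)
  have hfac : ∀ s : ℝ, ‖1 - (starRingEnd ℂ) (exp (s * I)) * z‖ ≤ d + |t - s| ∧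
      ‖1 - (starRingEnd ℂ) (exp (s * I)) * z‖ ≤ 3 := by
    intro s
    rw [norm_one_sub_conj_mul (norm_exp_ofReal_mul_I s)]
    have h1 : ‖z - exp (s * I)‖ ≤ ‖z - exp (t * I)‖ + ‖exp (t * I) - exp (s * I)‖ :=
      norm_sub_le_norm_sub_add_norm_sub _ _ _
    have h2 : ‖exp (t * I) - exp (s * I)‖ ≤ 2 := by
      refine (norm_sub_le _ _).trans ?_
      rw [norm_exp_ofReal_mul_I, norm_exp_ofReal_mul_I]; norm_num
    exact ⟨by linarith [norm_exp_sub_exp_le t s], by linarith⟩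
  have hA := hfac α
  have hB := hfac β
  rw [abs_of_pos (by linarith [ht.1])] at hA
  rw [abs_sub_comm, abs_of_pos (by linarith [ht.2])] at hB
  have hprod : ‖1 - (starRingEnd ℂ) (exp (α * I)) * z‖ *
      ‖1 - (starRingEnd ℂ) (exp (β * I)) * z‖ ≤ 6 * d := by
    rcases min_choice (t - α) (β - t) with hm | hm
    · rw [← hd] at hm
      nlinarith [norm_nonneg (1 - (starRingEnd ℂ) (exp (α * I)) * z),
        norm_nonneg (1 - (starRingEnd ℂ) (exp (β * I)) * z)]
    · rw [← hd] at hm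
      nlinarith [norm_nonneg (1 - (starRingEnd ℂ) (exp (α * I)) * z),
        norm_nonneg (1 - (starRingEnd ℂ) (exp (β * I)) * z)]
  have hexp := (norm_exp_herglotz_le (integrable_logRatio hφ) (h.awayFrom_logRatio t) hδ hδ2
    (norm_exp_ofReal_mul_I t) hz).1.trans (Real.exp_le_exp.2 (integral_norm_logRatio_le hφ))
  rw [outerExtension, norm_pow, norm_mul, norm_mul]
  exact pow_le_pow_left₀ (by positivity)
    (mul_le_mul hprod hexp (norm_nonneg _) ((by positivity : (0 : ℝ) ≤ _).trans hprod)) N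

end BeurlingCarleson

/-! ### Derivative estimates for the cutoff function, and the conclusion. -/

namespace BeurlingCarleson

variable {E : Set ℂ} {α β t : ℝ}

/-- Holomorphic continuation of the cutoff function to a disc around a point of a gap. -/
theorem IsGap.exists_extension (h : IsGap E α β) (hcl : IsClosed E) (hT : E ⊆ Metric.sphere 0 1)
    (hφ : Integrable (fun ζ => Real.log (phi E ζ)) circleMeasure) (N : ℕ)
    (ν₁ ν₂ : Measure ℂ) [IsFiniteMeasure ν₁] [IsFiniteMeasure ν₂] (ht : t ∈ Ioo α β) :
    ∃ G : ℂ → ℂ,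
      DifferentiableOn ℂ G
        (Metric.ball (t : ℂ) ((2 / Real.pi * min (t - α) (β - t)) ^ 2 / 8)) ∧
      (∀ s : ℝ, (s : ℂ) ∈ Metric.ball (t : ℂ) ((2 / Real.pi * min (t - α) (β - t)) ^ 2 / 8) →
        cutoff E (singularExp E ν₁) (singularExp E ν₂) (outerFunction fun ζ => phi E ζ ^ N)
          (exp (s * I)) = G s) ∧
      ∀ w ∈ Metric.ball (t : ℂ) ((2 / Real.pi * min (t - α) (β - t)) ^ 2 / 8),
        ‖G w‖ ≤ Real.exp (∫ _, ‖(1 : ℝ)‖ ∂ν₁.restrict E) * Real.exp (∫ _, ‖(1 : ℝ)‖ ∂ν₂.restrict E) *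
          (6 * min (t - α) (β - t) *
            Real.exp (∫ ζ, ‖Real.log (phi E ζ)‖ ∂circleMeasure + 4 * Real.log 2)) ^ N := by
  have hδ := IsGap.chord_pos ht
  have hL := fun z => norm_outerExtension_le (z := z) h hφ N ht
  have hd0 : 0 < min (t - α) (β - t) := lt_min (by linarith [ht.1]) (by linarith [ht.2])
  have hdpi : min (t - α) (β - t) ≤ Real.pi := by
    linarith [min_le_left (t - α) (β - t), min_le_right (t - α) (β - t), h.right_le]
  have hπ := Real.pi_gt_three
  have hδ2 : 2 / Real.pi * min (t - α) (β - t) ≤ 2 := by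
    rw [div_mul_eq_mul_div, div_le_iff₀ Real.pi_pos]; linarith
  have hδd : 2 / Real.pi * min (t - α) (β - t) ≤ min (t - α) (β - t) := by
    rw [div_mul_eq_mul_div, div_le_iff₀ Real.pi_pos]
    nlinarith
  have A₁ := h.awayFrom_restrict hcl hT ν₁ t
  have A₂ := h.awayFrom_restrict hcl hT ν₂ t
  have hdiff := differentiableOn_outerExtension h hφ N t
  have hd₁ := min_le_left (t - α) (β - t)
  have hd₂ := min_le_right (t - α) (β - t)
  generalize 2 / Real.pi * min (t - α) (β - t) = δ at *
  -- The map `w ↦ exp (w * I)` at most doubles these distances, so the radius `δ² / 8` lands where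
  -- the Herglotz bounds hold.
  have hclose : ∀ w ∈ Metric.ball (t : ℂ) (δ ^ 2 / 8),
      ‖exp (w * I) - exp (t * I)‖ ≤ δ ^ 2 / 4 := by
    intro w hw
    rw [Metric.mem_ball, dist_eq_norm] at hw
    exact (norm_exp_mul_I_sub_le (hw.le.trans (by nlinarith))).trans (by linarith)
  have hmaps : MapsTo (fun w : ℂ => exp (w * I)) (Metric.ball (t : ℂ) (δ ^ 2 / 8))
      (Metric.ball (exp (t * I)) δ) := by
    intro w hw
    rw [Metric.mem_ball, dist_eq_norm]
    exact (hclose w hw).trans_lt (by nlinarith)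
  refine ⟨fun w => exp (herglotz (ν₁.restrict E) (fun _ => 1) (exp (w * I))) *
      exp (-herglotz (ν₂.restrict E) (fun _ => 1) (exp (w * I))) *
      outerExtension E N α β (exp (w * I)), ?_, fun s hs => ?_, fun w hw => ?_⟩
  · have hm : DifferentiableOn ℂ (fun w : ℂ => exp (w * I)) (Metric.ball (t : ℂ) (δ ^ 2 / 8)) := by
      fun_prop
    have D₁ := (differentiableOn_herglotz (integrable_const (1 : ℝ)) A₁).comp hm hmaps
    have D₂ := (differentiableOn_herglotz (integrable_const (1 : ℝ)) A₂).comp hm hmaps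
    exact (D₁.cexp.mul D₂.neg.cexp).mul (hdiff.comp hm hmaps)
  · have hst : |s - t| < δ ^ 2 / 8 := by
      rwa [Metric.mem_ball, dist_eq_norm, ← ofReal_sub, norm_real, Real.norm_eq_abs] at hs
    have hst' : |s - t| < min (t - α) (β - t) := hst.trans (by nlinarith)
    rw [abs_lt] at hst'
    have hs' : s ∈ Ioo α β := ⟨by linarith [hst'.1], by linarith [hst'.2]⟩
    exact (cutoff_eq_of_isGap h hcl hT hφ N ν₁ ν₂ hs').2
  · have hn := norm_exp_ofReal_mul_I t
    have e₁ := (norm_exp_herglotz_le (integrable_const (1 : ℝ)) A₁ hδ hδ2 hn (hclose w hw)).1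
    have e₂ := (norm_exp_herglotz_le (integrable_const (1 : ℝ)) A₂ hδ hδ2 hn (hclose w hw)).2
    rw [norm_mul, norm_mul]
    exact mul_le_mul (mul_le_mul e₁ e₂ (norm_nonneg _) (by positivity)) (hL _ (hclose w hw))
      (norm_nonneg _) (by positivity)

/-- Cauchy's estimate on a circle of radius comparable to `d²` costs `d ^ (2 * k)` out of the bound
`d ^ N`; the hypothesis on `N` leaves at least `d ^ 2`, and `d ≤ |t - s|`. -/
theorem exists_norm_iteratedDeriv_cutoff_le (hcl : IsClosed E) (hT : E ⊆ Metric.sphere 0 1)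
    (hne : (angles E).Nonempty)
    (hφ : Integrable (fun ζ => Real.log (phi E ζ)) circleMeasure) {N k : ℕ} (hk : 2 * k + 2 ≤ N)
    (ν₁ ν₂ : Measure ℂ) [IsFiniteMeasure ν₁] [IsFiniteMeasure ν₂] {F : ℝ → ℂ}
    (hF : F = fun t : ℝ => cutoff E (singularExp E ν₁) (singularExp E ν₂)
      (outerFunction fun ζ => phi E ζ ^ N) (exp (t * I))) :
    (∀ t ∉ angles E, DifferentiableAt ℝ (iteratedDeriv k F) t) ∧
    ∃ C, 0 ≤ C ∧ ∀ t ∉ angles E, ∀ s ∈ angles E, ‖iteratedDeriv k F t‖ ≤ C * |t - s| ^ 2 := by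
  set M := Real.exp (∫ _, ‖(1 : ℝ)‖ ∂ν₁.restrict E) * Real.exp (∫ _, ‖(1 : ℝ)‖ ∂ν₂.restrict E)
  set Q := Real.exp (∫ ζ, ‖Real.log (phi E ζ)‖ ∂circleMeasure + 4 * Real.log 2)
  constructor
  · intro t ht
    obtain ⟨α, β, h, htI⟩ := exists_isGap hcl hne ht
    obtain ⟨G, hG, hFG, -⟩ := h.exists_extension hcl hT hφ N ν₁ ν₂ htI
    refine ((iteratedDeriv_eq_of_eq_ofReal Metric.isOpen_ball hG (F := F) (fun s hs => ?_) k).2 t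
      (Metric.mem_ball_self ?_)).2
    · rw [hF]; exact hFG s hs
    · have := IsGap.chord_pos htI
      positivity
  · refine ⟨k.factorial * (M * (6 * Q) ^ N) * (4 * Real.pi ^ 2) ^ k * Real.pi ^ (N - 2 * k - 2),
      by positivity, fun t ht s hs => ?_⟩
    obtain ⟨α, β, h, htI⟩ := exists_isGap hcl hne ht
    obtain ⟨G, hG, hFG, hGb⟩ := h.exists_extension hcl hT hφ N ν₁ ν₂ htI
    have hδ := IsGap.chord_pos htI
    have hds := h.le_of_mem hs t
    rw [abs_sub_comm] at hds
    have hd0 : 0 < min (t - α) (β - t) :=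
      lt_min (by linarith [htI.1]) (by linarith [htI.2])
    have hdpi : min (t - α) (β - t) ≤ Real.pi := by
      linarith [min_le_left (t - α) (β - t), min_le_right (t - α) (β - t), h.right_le]
    generalize min (t - α) (β - t) = d at *
    -- Half the radius of holomorphy, so that the closed disc fits inside. It equals `d² / (4π²)`,
    -- the source of the factor `(4π²) ^ k` in the constant.
    set r := (2 / Real.pi * d) ^ 2 / 16 with hr
    have hr0 : 0 < r := by positivity
    have hsub : Metric.closedBall (t : ℂ) r ⊆
        Metric.ball (t : ℂ) ((2 / Real.pi * d) ^ 2 / 8) :=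
      Metric.closedBall_subset_ball (by rw [hr]; nlinarith [pow_pos hδ 2])
    rw [((iteratedDeriv_eq_of_eq_ofReal Metric.isOpen_ball hG (F := F)
      (fun s hs => by rw [hF]; exact hFG s hs) k).2 t
      (Metric.mem_ball_self (by positivity))).1]
    have hdc : DiffContOnCl ℂ G (Metric.ball (t : ℂ) r) := by
      refine DifferentiableOn.diffContOnCl ?_
      rw [closure_ball _ hr0.ne']
      exact hG.mono hsub
    have hcauchy := norm_iteratedDeriv_le_of_forall_mem_sphere_norm_le k hr0 hdc
      fun z hz => hGb z (hsub (Metric.sphere_subset_closedBall hz))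
    refine hcauchy.trans ?_
    -- One part of `d ^ N` cancels `r ^ k`, a square remains, and the surplus power is absorbed
    -- using `d ≤ π`.
    have hNk : N = (N - 2 * k - 2) + 2 * k + 2 := by omega
    have hdN : d ^ N = d ^ (N - 2 * k - 2) * (d ^ 2) ^ k * d ^ 2 := by
      rw [← pow_mul, ← pow_add, ← pow_add, ← hNk]
    have hrk : r ^ k * (4 * Real.pi ^ 2) ^ k = (d ^ 2) ^ k := by
      rw [← mul_pow, hr]
      congr 1
      field_simp
      norm_num
    rw [div_le_iff₀ (pow_pos hr0 k)]
    calc k.factorial * (M * (6 * d * Q) ^ N)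
        = k.factorial * (M * (6 * Q) ^ N) * d ^ N := by
          rw [show 6 * d * Q = 6 * Q * d by ring, mul_pow _ d]; ring
      _ = k.factorial * (M * (6 * Q) ^ N) * (4 * Real.pi ^ 2) ^ k * d ^ (N - 2 * k - 2) * d ^ 2 *
            r ^ k := by rw [hdN, ← hrk]; ring
      _ ≤ k.factorial * (M * (6 * Q) ^ N) * (4 * Real.pi ^ 2) ^ k * Real.pi ^ (N - 2 * k - 2) *
            |t - s| ^ 2 * r ^ k := by gcongr

theorem angles_nonempty (hE : 0 < circleMeasure E) (hT : E ⊆ Metric.sphere 0 1) :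
    (angles E).Nonempty := by
  obtain ⟨ζ, hζ⟩ := nonempty_of_measure_ne_zero hE.ne'
  obtain ⟨s, -, rfl⟩ := exists_angle_near (mem_sphere_zero_iff_norm.1 (hT hζ)) 0
  exact ⟨s, hζ⟩

end BeurlingCarleson

theorem mainTheorem11 :
    (∀ E : Set ℂ, BeurlingCarleson.IsBeurlingCarleson E →
      0 < BeurlingCarleson.circleMeasure E →
      Integrable (fun ζ => Real.log (BeurlingCarleson.phi E ζ)) BeurlingCarleson.circleMeasure) ∧
    ∀ n : ℕ, ∃ N₀ : ℕ, ∀ N : ℕ, N₀ ≤ N →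
      ∀ E : Set ℂ, BeurlingCarleson.IsBeurlingCarleson E →
        0 < BeurlingCarleson.circleMeasure E →
      ∀ ν₁ ν₂ : Measure ℂ, IsFiniteMeasure ν₁ → IsFiniteMeasure ν₂ →
        ν₁ Eᶜ = 0 → ν₂ Eᶜ = 0 →
      ∀ g₁ g₂ s : ℂ → ℂ,
        g₁ = BeurlingCarleson.singularExp E ν₁ →
        g₂ = BeurlingCarleson.singularExp E ν₂ →
        s = BeurlingCarleson.outerFunction (fun ζ => BeurlingCarleson.phi E ζ ^ N) →
        (∀ ζ ∈ Metric.sphere (0 : ℂ) 1 \ E, BeurlingCarleson.HasBoundaryValue g₁ ζ ∧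
          BeurlingCarleson.HasBoundaryValue g₂ ζ ∧ BeurlingCarleson.HasBoundaryValue s ζ) ∧
        ContDiff ℝ n
          (fun t : ℝ => BeurlingCarleson.cutoff E g₁ g₂ s (exp (t * I))) := by
  refine ⟨fun E hE hm => BeurlingCarleson.integrable_log_phi hE
    -- Each of the `n` derivatives costs two powers of the distance, and two more are kept for
    -- differentiability at the points of `E`.
    (BeurlingCarleson.angles_nonempty hm hE.2.1), fun n => ⟨2 * n + 2, ?_⟩⟩
  rintro N hN E hE hm ν₁ ν₂ hν₁ hν₂ - - g₁ g₂ s rfl rfl rfl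
  have hne := BeurlingCarleson.angles_nonempty hm hE.2.1
  have hφ := BeurlingCarleson.integrable_log_phi hE hne
  obtain ⟨hcl, hT, -⟩ := hE
  constructor
  · rintro ζ ⟨hζ, hζE⟩
    obtain ⟨t, -, rfl⟩ :=
      BeurlingCarleson.exists_angle_near (mem_sphere_zero_iff_norm.1 hζ) 0
    obtain ⟨α, β, h, htI⟩ := BeurlingCarleson.exists_isGap (t := t) hcl hne hζE
    exact (BeurlingCarleson.cutoff_eq_of_isGap h hcl hT hφ N ν₁ ν₂ htI).1
  · refine BeurlingCarleson.contDiff_of_norm_iteratedDeriv_le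
      (K := BeurlingCarleson.angles E) (fun t ht => ?_) (fun k hk => ?_) (fun k hk => ?_)
    · exact indicator_of_notMem (fun h => h.2 ht) _
    · exact (BeurlingCarleson.exists_norm_iteratedDeriv_cutoff_le hcl hT hne hφ (by omega)
        ν₁ ν₂ rfl).1
    · exact (BeurlingCarleson.exists_norm_iteratedDeriv_cutoff_le hcl hT hne hφ (by omega)
        ν₁ ν₂ rfl).2
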